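/- Let $\mathcal X$ be a measurable space, let $k:\mathcal X\times\mathcal X\to\mathbb R$ be a measurable positive (semi-)definite kernel (symmetric, all Gram matrices positive semidefinite), and let $\mathcal D$ be a probability distribution on $\mathcal X\times\{\pm1\}$. Let $n\ge 2$ and $\delta\in(0,1)$, and draw $n$ training points $(x_i,y_i)$ iid from $\mathcal D$; write $X=(x_1,\dots,x_n)$, $Y=(y_1,\dots,y_n)$, $K_{XX}=(k(x_i,x_j))_{ij}$ and $K_{xX}=(k(x,x_i))_i$. For samples on which $K_{XX}$ is invertible and for $\Upsilon\in\mathbb R^n$, let $f_\Upsilon(x)=K_{xX}K_{XX}^{-1}\Upsilon$ be the kernel interpolator and $\varepsilon_\Upsilon=\mathbb P_{(x,y)\sim\mathcal D}[\operatorname{sign} f_\Upsilon(x)\neq y]$ its zero–one risk (with $\operatorname{sign}0=0$, so that $f_\Upsilon(x)=0$ counts as an error). Let $P_{\mathrm{GP}}=\mathcal N(0,K_{XX})$, let $P_Y=\mathbb P_{\Upsilon\sim P_{\mathrm{GP}}}[\operatorname{sign}\Upsilon=Y]$ be the Gaussian orthant probability, let $Q_{\mathrm{GP}}$ be $P_{\mathrm{GP}}$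 conditioned on $\operatorname{sign}\Upsilon=Y$, let $Y_{\mathrm{com}}=\mathbb E_{\Upsilon\sim Q_{\mathrm{GP}}}\Upsilon$ be the centre-of-mass labels, and let $$\mathcal A(k,X,Y)=n\left(\log 2-\tfrac12\right)+|K_{XX}|^{1/n}\left[\left(\tfrac12-\tfrac1\pi\right)\operatorname{tr}K_{XX}^{-1}+\tfrac1\pi\,Y^TK_{XX}^{-1}Y\right],$$ where $|K_{XX}|$ is the determinant. Then: (i) with probability at least $1-\delta$ over the training sample, if $K_{XX}$ is invertible then $$\varepsilon_Y\le \mathrm e\cdot\left[1-\exp\left(-\frac{\mathcal A(k,X,Y)+\log(2n/\delta)}{n-1}\right)\right];$$ (ii) with probability at least $1-\delta$ over the training sample, if $K_{XX}$ is invertible then $$\varepsilon_{Y_{\mathrm{com}}}\le \mathrm e\cdot\left[1-\exp\left(-\frac{\log(1/P_Y)+\log(2n/\delta)}{n-1}\right)\right].$$ In particular, if $K_{XX}$ is almost surely invertible, each bound holds with probability at least $1-\delta$. -/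

import Mathlib

open MeasureTheory ProbabilityTheory
open scoped Matrix

namespace KernelPACBayes

noncomputable section

/-- Binary labels `{±1}`, as a measurable subtype of `ℝ`. -/
abbrev Label : Type := {y : ℝ // y = 1 ∨ y = -1}

/-- The training inputs `X` of a training sample. -/
def inputs {𝒳 : Type*} {n : ℕ} (S : Fin n → 𝒳 × Label) : Fin n → 𝒳 := fun i => (S i).1

/-- The vector `Y ∈ {±1}ⁿ` of training labels of a training sample. -/
def labels {𝒳 : Type*} {n : ℕ} (S : Fin n → 𝒳 × Label) : Fin n → ℝ := fun i => ((S i).2 : ℝ)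

/-- The Gram matrix `K_XX`. -/
def gramMatrix {𝒳 : Type*} {n : ℕ} (k : 𝒳 → 𝒳 → ℝ) (X : Fin n → 𝒳) :
    Matrix (Fin n) (Fin n) ℝ :=
  Matrix.of fun i j => k (X i) (X j)

/-- The Gram vector `K_xX`. -/
def gramVector {𝒳 : Type*} {n : ℕ} (k : 𝒳 → 𝒳 → ℝ) (X : Fin n → 𝒳) (x : 𝒳) : Fin n → ℝ :=
  fun i => k x (X i)

/-- The kernel interpolator `f_Υ(x) = K_xX K_XX⁻¹ Υ` (meaningful when `K_XX` is invertible). -/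
def interpolator {𝒳 : Type*} {n : ℕ} (k : 𝒳 → 𝒳 → ℝ) (X : Fin n → 𝒳) (Υ : Fin n → ℝ) (x : 𝒳) :
    ℝ :=
  gramVector k X x ⬝ᵥ ((gramMatrix k X)⁻¹ *ᵥ Υ)

/-- The zero-one risk of the classifier `sign ∘ f`: the probability, for `(x, y) ∼ D`, that
`sign (f x) ≠ y`. Here `sign 0 = 0`, so that `f x = 0` counts as an error. -/
def risk {𝒳 : Type*} [MeasurableSpace 𝒳] (D : Measure (𝒳 × Label)) (f : 𝒳 → ℝ) : ℝ :=
  D.real {z | Real.sign (f z.1) ≠ (z.2 : ℝ)}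

/-- The kernel complexity
`A(k, X, Y) = n (log 2 - 1/2) + |K|^{1/n} [(1/2 - 1/π) tr K⁻¹ + (1/π) Yᵀ K⁻¹ Y]`, `K = K_XX`. -/
def complexity {𝒳 : Type*} {n : ℕ} (k : 𝒳 → 𝒳 → ℝ) (X : Fin n → 𝒳) (Y : Fin n → ℝ) : ℝ :=
  (n : ℝ) * (Real.log 2 - 1 / 2) +
    (gramMatrix k X).det ^ (1 / (n : ℝ)) *
      ((1 / 2 - 1 / Real.pi) * (gramMatrix k X)⁻¹.trace +
        1 / Real.pi * (Y ⬝ᵥ ((gramMatrix k X)⁻¹ *ᵥ Y)))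

/-- The GP prior `P_GP = N(0, K_XX)` over training labels. -/
def gpPrior {𝒳 : Type*} {n : ℕ} (k : 𝒳 → 𝒳 → ℝ) (X : Fin n → 𝒳) :
    Measure (EuclideanSpace ℝ (Fin n)) :=
  multivariateGaussian 0 (gramMatrix k X)

/-- The orthant `sign Υ = Y`. -/
def orthant {n : ℕ} (Y : Fin n → ℝ) : Set (EuclideanSpace ℝ (Fin n)) :=
  {Υ | ∀ i, Real.sign (Υ i) = Y i}

/-- The Gaussian orthant probability `P_Y`. -/
def orthantProb {𝒳 : Type*} {n : ℕ} (k : 𝒳 → 𝒳 → ℝ) (X : Fin n → 𝒳) (Y : Fin n → ℝ) : ℝ :=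
  (gpPrior k X).real (orthant Y)

/-- The GP posterior `Q_GP = N(0, K_XX | sign Υ = Y)` over training labels. -/
def gpPosterior {𝒳 : Type*} {n : ℕ} (k : 𝒳 → 𝒳 → ℝ) (X : Fin n → 𝒳) (Y : Fin n → ℝ) :
    Measure (EuclideanSpace ℝ (Fin n)) :=
  cond (gpPrior k X) (orthant Y)

/-- The centre-of-mass labels `Y_com`, the mean of `Q_GP`. -/
def comLabels {𝒳 : Type*} {n : ℕ} (k : 𝒳 → 𝒳 → ℝ) (X : Fin n → 𝒳) (Y : Fin n → ℝ) :
    Fin n → ℝ :=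
  (∫ Υ, Υ ∂(gpPosterior k X Y)).ofLp

/-- The risk bound `e [1 - exp (-(c + log (2n/δ)) / (n - 1))]` of complexity `c`. -/
def riskBound (n : ℕ) (δ c : ℝ) : ℝ :=
  Real.exp 1 * (1 - Real.exp (-((c + Real.log (2 * (n : ℝ) / δ)) / ((n : ℝ) - 1))))

end

end KernelPACBayes

open KernelPACBayes

/-! The bounds combine a PAC-Bayes inequality for Gibbs risk, a Grünbaum inequality passing from
Gibbs risk to the risk of the mean, and two explicit posteriors.

PAC-Bayes. The process prior is fixed before the labels are seen, so a random predictor correct on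
all `n` training points is unlikely to have large risk: heuristically the weight 1[consistent] / (1
- risk)^n has mean at most one. To work with finite Gaussian vectors only, 1 - risk is replaced by
the fraction of correct points in a group formed by one training point and `l` ghost points.
Swapping a training point with a ghost of its group preserves the joint law, and averaging over all
swaps bounds the mean weight by one (`sum_ghostWeight_le`, `lintegral_ghostWeight_le_one`). Markov's
inequality gives a single exceptional event; off it, a change of measure to any posterior Q
supported on the orthant of the labels yields `-n log ((1 + l g) / (l + 1)) ≤ KL(Q, P) + log (1/δ)`,
where `g` is the Gibbs accuracy (`pacBayes_integral`). Taking `l = n` costs at most one unit, which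
`log (2n)` absorbs.

Grünbaum. Given its training values Υ, the process at `x` is `f_Υ(x)` plus independent Gaussian
noise. When Υ is a linear image of a standard Gaussian conditioned on a convex set, this value has a
log-concave distribution function, by Prékopa's theorem. If the mean of Υ is a nonnegative multiple
of `v` and `f_v` errs at `x`, the value times the label has nonpositive mean, hence is nonpositive
with probability at least 1/e (`hitProb_add_exp_neg_one_le`). So the risk of `f_v` is at most e
times the Gibbs risk.

Posteriors. The prior conditioned on the orthant has mean `Y_com` and divergence `log (1/P_Y)`. The
Gaussian with covariance |K|^{1/n} I conditioned on the orthant has mean a positive multiple of Y,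
and its divergence is exactly the complexity 𝒜. -/

namespace KernelPACBayes

open scoped ENNReal

/-! ### Log-concavity and the Prékopa-Leindler inequality -/

/-- Log-concavity of a function with values in `[0, ∞]`. -/
def LogConcave {E : Type*} [AddCommMonoid E] [Module ℝ E] (f : E → ℝ≥0∞) : Prop :=
  ∀ (x y : E) (a b : ℝ), 0 < a → 0 < b → a + b = 1 → f x ^ a * f y ^ b ≤ f (a • x + b • y)

/-- Tonelli on the region below the graph, whose vertical section over `x` has length `f x`.
Infinite values are allowed, and levels are real, so that each level contributes a set to which
Brunn-Minkowski applies. -/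
theorem lintegral_eq_lintegral_measure_ofReal_lt {α : Type*} [MeasurableSpace α] (μ : Measure α)
    [SFinite μ] {f : α → ℝ≥0∞} (hf : Measurable f) :
    ∫⁻ x, f x ∂μ = ∫⁻ t in Set.Ioi (0 : ℝ), μ {x | ENNReal.ofReal t < f x} := by
  have key : ∀ c : ℝ≥0∞, volume {t : ℝ | 0 < t ∧ ENNReal.ofReal t < c} = c := by
    intro c
    induction c using ENNReal.recTopCoe with
    | top =>
      have : {t : ℝ | 0 < t ∧ ENNReal.ofReal t < ⊤} = Set.Ioi 0 := by ext; simp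
      rw [this, Real.volume_Ioi]
    | coe c =>
      have : {t : ℝ | 0 < t ∧ ENNReal.ofReal t < c} = Set.Ioo 0 (c : ℝ) := by
        ext t
        simp only [Set.mem_ofPred_eq, Set.mem_Ioo]
        refine and_congr_right fun ht => ?_
        rw [← ENNReal.ofReal_coe_nnreal, ENNReal.ofReal_lt_ofReal_iff_of_nonneg ht.le]
      rw [this, Real.volume_Ioo, sub_zero, ENNReal.ofReal_coe_nnreal]
  have hS : MeasurableSet {p : α × ℝ | 0 < p.2 ∧ ENNReal.ofReal p.2 < f p.1} :=
    (measurableSet_lt measurable_const measurable_snd).inter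
      (measurableSet_lt (f := fun p : α × ℝ => ENNReal.ofReal p.2) (g := fun p => f p.1)
        (by fun_prop) (by fun_prop))
  have h1 := Measure.prod_apply (μ := μ) (ν := (volume : Measure ℝ)) hS
  have h2 := Measure.prod_apply_symm (μ := μ) (ν := (volume : Measure ℝ)) hS
  rw [h1] at h2
  calc ∫⁻ x, f x ∂μ = ∫⁻ x, volume (Prod.mk x ⁻¹' {p : α × ℝ | 0 < p.2 ∧
        ENNReal.ofReal p.2 < f p.1}) ∂μ := by
        refine lintegral_congr fun x => ?_
        exact (key (f x)).symm
    _ = _ := h2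
    _ = _ := by
        rw [← lintegral_indicator measurableSet_Ioi]
        refine lintegral_congr fun t => ?_
        by_cases ht : 0 < t
        · rw [Set.indicator_of_mem (by simpa using ht)]
          congr 1
          ext x
          simp [ht]
        · rw [Set.indicator_of_notMem (by simpa using ht)]
          convert measure_empty (μ := μ)
          ext x
          simp [ht]

/-- The one-dimensional Brunn-Minkowski inequality for compact sets. -/
theorem volume_add_le_of_isCompact {A B C : Set ℝ} (hA : IsCompact A) (hB : IsCompact B)
    (hA' : A.Nonempty) (hB' : B.Nonempty) {a b : ℝ} (ha : 0 < a) (hb : 0 < b)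
    (h : ∀ x ∈ A, ∀ y ∈ B, a * x + b * y ∈ C) :
    ENNReal.ofReal a * volume A + ENNReal.ofReal b * volume B ≤ volume C := by
  -- With u the maximum of A and v the minimum of B, both aA + bv and au + bB lie in C. The first is
  -- to the left of au + bv and the second to its right, so they overlap in at most one point.
  obtain ⟨u, hu, hu'⟩ := hA.exists_isGreatest hA'
  obtain ⟨v, hv, hv'⟩ := hB.exists_isLeast hB'
  set A' := (fun x => a * x + b * v) '' A
  set B' := (fun y => a * u + b * y) '' B
  have hcA : IsCompact A' := hA.image (by fun_prop)
  have hcB : IsCompact B' := hB.image (by fun_prop)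
  have e1 : volume A' = ENNReal.ofReal a * volume A := by
    have : A' = (fun x => x + b * v) '' ((a • ·) '' A) := by
      simp [A', Set.image_image]
    rw [this, Set.image_add_right, measure_preimage_add_right, Set.image_smul,
      Measure.addHaar_smul]
    simp [abs_of_pos ha]
  have e2 : volume B' = ENNReal.ofReal b * volume B := by
    have : B' = (fun x => a * u + x) '' ((b • ·) '' B) := by
      simp [B', Set.image_image]
    rw [this, Set.image_add_left, measure_preimage_add, Set.image_smul,
      Measure.addHaar_smul]
    simp [abs_of_pos hb]
  have hd : AEDisjoint volume A' B' := by
    refine measure_mono_null (t := {a * u + b * v}) ?_ (by simp)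
    rintro _ ⟨⟨x, hx, rfl⟩, ⟨y, hy, hxy⟩⟩
    have h1 := mul_le_mul_of_nonneg_left (hu' hx) ha.le
    have h2 := mul_le_mul_of_nonneg_left (hv' hy) hb.le
    simp only [Set.mem_singleton_iff] at *
    linarith
  rw [← e1, ← e2, ← measure_union₀ hcB.measurableSet.nullMeasurableSet hd]
  refine measure_mono ?_
  rintro _ (⟨x, hx, rfl⟩ | ⟨y, hy, rfl⟩)
  · exact h _ hx _ hv
  · exact h _ hu _ hy

/-- The one-dimensional Brunn-Minkowski inequality. -/
theorem volume_add_le_of_measurableSet {A B C : Set ℝ} (hA : MeasurableSet A)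
    (hB : MeasurableSet B) (hA' : A.Nonempty) (hB' : B.Nonempty) {a b : ℝ} (ha : 0 < a)
    (hb : 0 < b) (h : ∀ x ∈ A, ∀ y ∈ B, a * x + b * y ∈ C) :
    ENNReal.ofReal a * volume A + ENNReal.ofReal b * volume B ≤ volume C := by
  have main : ∀ K ⊆ A, IsCompact K → ∀ L ⊆ B, IsCompact L →
      ENNReal.ofReal a * volume K + ENNReal.ofReal b * volume L ≤ volume C := by
    intro K hK hKc L hL hLc
    obtain ⟨x, hx⟩ := hA'
    obtain ⟨y, hy⟩ := hB'
    -- Inner approximations by compacts may be empty; adding a fixed point of each set repairs this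
    -- and only increases the left side.
    refine le_trans ?_ (volume_add_le_of_isCompact (hKc.insert x) (hLc.insert y)
      ⟨x, by simp⟩ ⟨y, by simp⟩ ha hb ?_)
    · gcongr <;> simp
    · exact fun p hp q hq => h _ (Set.insert_subset hx hK hp) _ (Set.insert_subset hy hL hq)
  have ha0 : ENNReal.ofReal a ≠ 0 := by simpa using ha
  have hb0 : ENNReal.ofReal b ≠ 0 := by simpa using hb
  have main2 : ∀ L ⊆ B, IsCompact L →
      ENNReal.ofReal a * volume A + ENNReal.ofReal b * volume L ≤ volume C := by
    intro L hL hLc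
    have hfin : ENNReal.ofReal b * volume L ≠ ⊤ :=
      ENNReal.mul_ne_top ENNReal.ofReal_ne_top hLc.measure_lt_top.ne
    have hle := main ∅ (by simp) isCompact_empty L hL hLc
    have : volume A ≤ (volume C - ENNReal.ofReal b * volume L) / ENNReal.ofReal a := by
      rw [hA.measure_eq_iSup_isCompact]
      refine iSup₂_le fun K hK => iSup_le fun hKc => ?_
      rw [ENNReal.le_div_iff_mul_le (Or.inl ha0) (Or.inl ENNReal.ofReal_ne_top), mul_comm]
      exact ENNReal.le_sub_of_add_le_right hfin (main K hK hKc L hL hLc)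
    rw [ENNReal.le_div_iff_mul_le (Or.inl ha0) (Or.inl ENNReal.ofReal_ne_top), mul_comm] at this
    calc _ ≤ volume C - ENNReal.ofReal b * volume L + ENNReal.ofReal b * volume L := by gcongr
      _ = volume C := tsub_add_cancel_of_le (le_trans le_add_self hle)
  by_cases hfin : ENNReal.ofReal a * volume A = ⊤
  · have := main2 ∅ (by simp) isCompact_empty
    rw [hfin] at this ⊢
    simpa using this
  have hle := main2 ∅ (by simp) isCompact_empty
  have : volume B ≤ (volume C - ENNReal.ofReal a * volume A) / ENNReal.ofReal b := by
    rw [hB.measure_eq_iSup_isCompact]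
    refine iSup₂_le fun L hL => iSup_le fun hLc => ?_
    rw [ENNReal.le_div_iff_mul_le (Or.inl hb0) (Or.inl ENNReal.ofReal_ne_top), mul_comm]
    exact ENNReal.le_sub_of_add_le_left hfin (main2 L hL hLc)
  rw [ENNReal.le_div_iff_mul_le (Or.inl hb0) (Or.inl ENNReal.ofReal_ne_top), mul_comm] at this
  calc _ ≤ ENNReal.ofReal a * volume A + (volume C - ENNReal.ofReal a * volume A) := by gcongr
    _ = volume C := add_tsub_cancel_of_le (le_trans le_self_add hle)

theorem ENNReal_geom_mean_le_arith_mean (x y : ℝ≥0∞) {a b : ℝ} (ha : 0 < a) (hb : 0 < b)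
    (hab : a + b = 1) :
    x ^ a * y ^ b ≤ ENNReal.ofReal a * x + ENNReal.ofReal b * y := by
  by_cases hx : x = ⊤
  · simp [hx, ENNReal.mul_top, ha]
  by_cases hy : y = ⊤
  · simp [hy, ENNReal.mul_top, hb]
  lift x to NNReal using hx
  lift y to NNReal using hy
  lift a to NNReal using ha.le
  lift b to NNReal using hb.le
  rw [← ENNReal.coe_rpow_of_nonneg _ ha.le, ← ENNReal.coe_rpow_of_nonneg _ hb.le]
  simp only [ENNReal.ofReal_coe_nnreal]
  exact_mod_cast NNReal.geom_mean_le_arith_mean2_weighted a b x y (by exact_mod_cast hab)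

/-- With equal suprema, the superlevel sets of `f` and `g` at a common level are both nonempty or
both empty, so the one-dimensional Brunn-Minkowski inequality holds level by level. Integrating over
levels gives the stronger bound by the arithmetic mean. -/
theorem prekopaLeindler_of_iSup_eq_one {f g h : ℝ → ℝ≥0∞} (hf : Measurable f) (hg : Measurable g)
    (hh : Measurable h) (hf1 : ⨆ x, f x = 1) (hg1 : ⨆ x, g x = 1) {a b : ℝ} (ha : 0 < a)
    (hb : 0 < b) (hab : a + b = 1) (H : ∀ x y, f x ^ a * g y ^ b ≤ h (a * x + b * y)) :
    (∫⁻ x, f x) ^ a * (∫⁻ x, g x) ^ b ≤ ∫⁻ x, h x := by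
  refine (ENNReal_geom_mean_le_arith_mean _ _ ha hb hab).trans ?_
  have hmeas : ∀ φ : ℝ → ℝ≥0∞, Measurable fun t : ℝ => volume {x | ENNReal.ofReal t < φ x} := by
    intro φ
    refine Antitone.measurable fun s t hst => measure_mono fun x hx => ?_
    exact lt_of_le_of_lt (ENNReal.ofReal_le_ofReal hst) hx
  rw [lintegral_eq_lintegral_measure_ofReal_lt volume hf,
    lintegral_eq_lintegral_measure_ofReal_lt volume hg,
    lintegral_eq_lintegral_measure_ofReal_lt volume hh,
    ← lintegral_const_mul _ (hmeas f), ← lintegral_const_mul _ (hmeas g),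
    ← lintegral_add_left ((hmeas f).const_mul _)]
  refine setLIntegral_mono (hmeas h) fun t ht => ?_
  rw [Set.mem_Ioi] at ht
  by_cases h1 : ENNReal.ofReal t < 1
  · obtain ⟨x, hx⟩ := lt_iSup_iff.1 (hf1 ▸ h1)
    obtain ⟨y, hy⟩ := lt_iSup_iff.1 (hg1 ▸ h1)
    refine volume_add_le_of_measurableSet (measurableSet_lt measurable_const hf)
      (measurableSet_lt measurable_const hg) ⟨x, hx⟩ ⟨y, hy⟩ ha hb fun x hx y hy => ?_
    refine lt_of_lt_of_le ?_ (H x y)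
    calc ENNReal.ofReal t = ENNReal.ofReal t ^ a * ENNReal.ofReal t ^ b := by
          rw [← ENNReal.rpow_add _ _ (by simpa using ht) ENNReal.ofReal_ne_top, hab,
            ENNReal.rpow_one]
      _ < f x ^ a * g y ^ b :=
          ENNReal.mul_lt_mul (ENNReal.rpow_lt_rpow hx ha) (ENNReal.rpow_lt_rpow hy hb)
  · have e : ∀ φ : ℝ → ℝ≥0∞, ⨆ x, φ x = 1 → {x | ENNReal.ofReal t < φ x} = ∅ := by
      intro φ hφ
      ext x
      simpa using ((le_iSup φ x).trans_eq hφ).trans (not_lt.1 h1)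
    simp [e f hf1, e g hg1]

/-- The one-dimensional Prékopa-Leindler inequality. -/
theorem prekopaLeindler {f g h : ℝ → ℝ≥0∞} (hf : Measurable f) (hg : Measurable g)
    (hh : Measurable h) {a b : ℝ} (ha : 0 < a) (hb : 0 < b) (hab : a + b = 1)
    (H : ∀ x y, f x ^ a * g y ^ b ≤ h (a * x + b * y)) :
    (∫⁻ x, f x) ^ a * (∫⁻ x, g x) ^ b ≤ ∫⁻ x, h x := by
  -- Truncation makes the suprema finite, so that both functions can be rescaled to supremum one;
  -- the factors recombine because the hypothesis is homogeneous of degrees a and b.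
  have bdd : ∀ N : ℕ, (∫⁻ x, min (f x) N) ^ a * (∫⁻ x, min (g x) N) ^ b ≤ ∫⁻ x, h x := by
    intro N
    set F := fun x => min (f x) N
    set G := fun x => min (g x) N
    have hFm : Measurable F := hf.min measurable_const
    have hGm : Measurable G := hg.min measurable_const
    have H' : ∀ x y, F x ^ a * G y ^ b ≤ h (a * x + b * y) := fun x y => by
      refine le_trans ?_ (H x y)
      gcongr
      · exact min_le_left _ _
      · exact min_le_left _ _
    set M := ⨆ x, F x
    set M' := ⨆ x, G x
    have hM : M ≠ ⊤ := ne_top_of_le_ne_top (ENNReal.natCast_ne_top N)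
      (iSup_le fun x => min_le_right _ _)
    have hM' : M' ≠ ⊤ := ne_top_of_le_ne_top (ENNReal.natCast_ne_top N)
      (iSup_le fun x => min_le_right _ _)
    by_cases h0 : M = 0
    · have : F = 0 := funext fun x => le_antisymm ((le_iSup F x).trans h0.le) bot_le
      simp [this, lintegral_zero_fun, ha]
    by_cases h0' : M' = 0
    · have : G = 0 := funext fun x => le_antisymm ((le_iSup G x).trans h0'.le) bot_le
      simp [this, lintegral_zero_fun, hb]
    have hc0 : M ^ a * M' ^ b ≠ 0 := by
      simp [ENNReal.rpow_eq_zero_iff, h0, h0', hM, hM']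
    have hct : M ^ a * M' ^ b ≠ ⊤ :=
      ENNReal.mul_ne_top (ENNReal.rpow_ne_top_of_nonneg ha.le hM)
        (ENNReal.rpow_ne_top_of_nonneg hb.le hM')
    have hinv : (M ^ a * M' ^ b)⁻¹ = M⁻¹ ^ a * M'⁻¹ ^ b := by
      rw [ENNReal.mul_inv (Or.inr (ENNReal.rpow_ne_top_of_nonneg hb.le hM'))
        (Or.inl (ENNReal.rpow_ne_top_of_nonneg ha.le hM)), ENNReal.inv_rpow, ENNReal.inv_rpow]
    have key := prekopaLeindler_of_iSup_eq_one (f := fun x => M⁻¹ * F x)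
      (g := fun x => M'⁻¹ * G x) (h := fun x => (M ^ a * M' ^ b)⁻¹ * h x)
      (hFm.const_mul _) (hGm.const_mul _) (hh.const_mul _)
      (by rw [← ENNReal.mul_iSup]; exact ENNReal.inv_mul_cancel h0 hM)
      (by rw [← ENNReal.mul_iSup]; exact ENNReal.inv_mul_cancel h0' hM') ha hb hab
      (fun x y => by
        rw [ENNReal.mul_rpow_of_nonneg _ _ ha.le, ENNReal.mul_rpow_of_nonneg _ _ hb.le,
          mul_mul_mul_comm, hinv]
        gcongr
        exact H' x y)
    rw [lintegral_const_mul _ hFm, lintegral_const_mul _ hGm, lintegral_const_mul _ hh,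
      ENNReal.mul_rpow_of_nonneg _ _ ha.le, ENNReal.mul_rpow_of_nonneg _ _ hb.le,
          mul_mul_mul_comm, ← hinv] at key
    have := mul_le_mul_right key (M ^ a * M' ^ b)
    rwa [← mul_assoc, ENNReal.mul_inv_cancel_left hc0 hct, ENNReal.mul_inv_cancel hc0 hct,
      one_mul] at this
  have mono : ∀ φ : ℝ → ℝ≥0∞, Measurable φ →
      Filter.Tendsto (fun N : ℕ => ∫⁻ x, min (φ x) N) Filter.atTop (nhds (∫⁻ x, φ x)) := by
    intro φ hφ
    refine lintegral_tendsto_of_tendsto_of_monotone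
      (fun N => (hφ.min measurable_const).aemeasurable)
      (Filter.Eventually.of_forall fun x N N' hN => min_le_min_left _ (by exact_mod_cast hN))
      (Filter.Eventually.of_forall fun x => ?_)
    have := (tendsto_const_nhds (x := φ x)).min ENNReal.tendsto_nat_nhds_top
    simpa using this
  -- Multiplication on [0, ∞] is discontinuous at 0 · ∞; the degenerate integrals are removed before
  -- the passage to the limit.
  by_cases h0 : ∫⁻ x, f x = 0
  · simp [h0, ha]
  by_cases h0' : ∫⁻ x, g x = 0
  · simp [h0', hb]
  refine le_of_tendsto' (ENNReal.Tendsto.mul ((mono f hf).ennrpow_const a) (Or.inl ?_)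
    ((mono g hg).ennrpow_const b) (Or.inl ?_)) bdd
  · simp [ENNReal.rpow_eq_zero_iff, h0, ha.le, ha]
  · simp [ENNReal.rpow_eq_zero_iff, h0', hb.le, hb]

/-- Prékopa's theorem: integrating out a real variable preserves log-concavity. -/
theorem LogConcave.lintegral_real {E : Type*} [AddCommMonoid E] [Module ℝ E] [MeasurableSpace E]
    {f : E × ℝ → ℝ≥0∞} (hf : LogConcave f) (hfm : Measurable f) :
    LogConcave fun x => ∫⁻ t, f (x, t) := by
  intro x y a b ha hb hab
  refine prekopaLeindler (by fun_prop) (by fun_prop) (by fun_prop) ha hb hab fun s t => ?_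
  simpa using hf (x, s) (y, t) a b ha hb hab

theorem LogConcave.mul {E : Type*} [AddCommMonoid E] [Module ℝ E] {f g : E → ℝ≥0∞}
    (hf : LogConcave f) (hg : LogConcave g) : LogConcave fun x => f x * g x := by
  intro x y a b ha hb hab
  rw [ENNReal.mul_rpow_of_nonneg _ _ ha.le, ENNReal.mul_rpow_of_nonneg _ _ hb.le,
    mul_mul_mul_comm]
  exact mul_le_mul' (hf x y a b ha hb hab) (hg x y a b ha hb hab)

theorem LogConcave.comp_linearMap {E F : Type*} [AddCommMonoid E] [Module ℝ E] [AddCommMonoid F]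
    [Module ℝ F] {f : F → ℝ≥0∞} (hf : LogConcave f) (L : E →ₗ[ℝ] F) :
    LogConcave fun x => f (L x) := by
  intro x y a b ha hb hab
  simpa using hf (L x) (L y) a b ha hb hab

theorem logConcave_indicator_of_convex {E : Type*} [AddCommMonoid E] [Module ℝ E] {C : Set E}
    (hC : Convex ℝ C) : LogConcave (C.indicator 1) := by
  intro x y a b ha hb hab
  by_cases hx : x ∈ C
  · by_cases hy : y ∈ C
    · simp [hx, hy, hC hx hy ha.le hb.le hab]
    · simp [hy, hb]
  · simp [hx, ha]

theorem logConcave_gaussianPDF : LogConcave (gaussianPDF 0 1) := by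
  intro x y a b ha hb hab
  set c : ℝ := (√(2 * Real.pi))⁻¹
  have hc : 0 < c := by positivity
  have e : ∀ x, gaussianPDF 0 1 x = ENNReal.ofReal (c * Real.exp (-x ^ 2 / 2)) := fun x => by
    simp [gaussianPDF, gaussianPDFReal, c]
  simp only [e]
  rw [ENNReal.ofReal_rpow_of_nonneg (by positivity) ha.le,
    ENNReal.ofReal_rpow_of_nonneg (by positivity) hb.le, ← ENNReal.ofReal_mul (by positivity)]
  refine ENNReal.ofReal_le_ofReal ?_
  rw [Real.mul_rpow hc.le (by positivity), Real.mul_rpow hc.le (by positivity), mul_mul_mul_comm,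
    ← Real.rpow_add hc, hab, Real.rpow_one, ← Real.exp_mul, ← Real.exp_mul, ← Real.exp_add]
  gcongr
  obtain rfl : b = 1 - a := by linarith
  simp only [smul_eq_mul]
  nlinarith [mul_nonneg (mul_nonneg ha.le hb.le) (sq_nonneg (x - y))]

/-- Integrating out a standard Gaussian variable preserves log-concavity. -/
theorem LogConcave.lintegral_gaussianReal {E : Type*} [AddCommMonoid E] [Module ℝ E]
    [MeasurableSpace E] {f : E × ℝ → ℝ≥0∞} (hf : LogConcave f) (hfm : Measurable f) :
    LogConcave fun x => ∫⁻ t, f (x, t) ∂gaussianReal 0 1 := by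
  have hm : Measurable fun p : E × ℝ => gaussianPDF 0 1 p.2 * f p :=
    ((measurable_gaussianPDF 0 1).comp measurable_snd).mul hfm
  have h := ((logConcave_gaussianPDF.comp_linearMap (LinearMap.snd ℝ E ℝ)).mul hf).lintegral_real hm
  convert h using 2 with x
  rw [gaussianReal_of_var_ne_zero 0 one_ne_zero, lintegral_withDensity_eq_lintegral_mul _
    (measurable_gaussianPDF 0 1) (by fun_prop)]
  rfl

/-- Integrating out independent standard Gaussian variables preserves log-concavity. -/
theorem LogConcave.lintegral_pi_gaussianReal {m : ℕ} : ∀ {E : Type*} [AddCommMonoid E] [Module ℝ E]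
    [MeasurableSpace E] {f : E × (Fin m → ℝ) → ℝ≥0∞}, LogConcave f → Measurable f →
    LogConcave fun x => ∫⁻ v, f (x, v) ∂Measure.pi fun _ : Fin m => gaussianReal 0 1 := by
  induction m with
  | zero =>
    intro E _ _ _ f hf hfm x y a b ha hb hab
    have e : ∀ φ : (Fin 0 → ℝ) → ℝ≥0∞, ∫⁻ v, φ v ∂(Measure.pi fun _ : Fin 0 => gaussianReal 0 1) =
        φ isEmptyElim := fun φ => by
      rw [Measure.pi_of_empty _ isEmptyElim, lintegral_dirac]
    simp only [e]
    have := hf (x, isEmptyElim) (y, isEmptyElim) a b ha hb hab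
    rwa [show (a • (x, isEmptyElim) + b • (y, isEmptyElim) : E × (Fin 0 → ℝ)) =
      (a • x + b • y, isEmptyElim) from Prod.ext rfl (Subsingleton.elim _ _)] at this
  | succ m ih =>
    intro E _ _ _ f hf hfm
    have hcons : Measurable fun p : (E × ℝ) × (Fin m → ℝ) =>
        (p.1.1, (Fin.cons p.1.2 p.2 : Fin (m + 1) → ℝ)) := by
      refine Measurable.prodMk (by fun_prop) (measurable_pi_lambda _ fun i => ?_)
      refine Fin.cases ?_ (fun j => ?_) i
      · simp only [Fin.cons_zero]; fun_prop
      · simp only [Fin.cons_succ]; fun_prop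
    -- The first coordinate becomes part of the parameter space E × ℝ, the induction hypothesis
    -- integrates out the remaining ones, and the first is integrated out last.
    have h1 := (ih (f := fun p : (E × ℝ) × (Fin m → ℝ) => f (p.1.1, Fin.cons p.1.2 p.2))
      (fun p q a b ha hb hab => by
        have := hf (p.1.1, Fin.cons p.1.2 p.2) (q.1.1, Fin.cons q.1.2 q.2) a b ha hb hab
        convert this using 2
        refine Prod.ext rfl (funext fun i => ?_)
        refine Fin.cases ?_ (fun j => ?_) i <;> simp) (hfm.comp hcons)).lintegral_gaussianReal
        (Measurable.lintegral_prod_right (hfm.comp hcons))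
    convert h1 using 2 with x
    have e := (measurePreserving_piFinSuccAbove
      (fun _ : Fin (m + 1) => gaussianReal 0 1) 0).symm
    rw [← e.lintegral_comp_emb (MeasurableEquiv.measurableEmbedding _), lintegral_prod]
    · simp [MeasurableEquiv.piFinSuccAbove, Fin.insertNthEquiv, Fin.insertNth_zero']
    · exact (hfm.comp (measurable_const.prodMk (MeasurableEquiv.measurable _))).aemeasurable

/-! ### Grünbaum's inequality -/

/-- Exponential majorant of a log-concave distribution function at a point `m`. -/
theorem exists_le_mul_exp_of_logConcave {F : ℝ → ℝ} (hmono : Monotone F) (h0 : ∀ t, 0 ≤ F t)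
    (hlc : ∀ s t a b : ℝ, 0 < a → 0 < b → a + b = 1 → F s ^ a * F t ^ b ≤ F (a * s + b * t))
    {m t₀ : ℝ} (ht₀ : t₀ < m) (hF : 0 < F t₀) :
    ∃ c, 0 ≤ c ∧ ∀ t, F t ≤ F m * Real.exp (c * (t - m)) := by
  have hm : 0 < F m := hF.trans_le (hmono ht₀.le)
  -- Chord slopes of the concave function log F decrease: a chord to the right of m is no steeper
  -- than one to the left.
  have slope : ∀ t, t < m → 0 < F t → ∀ u, m < u →
      (Real.log (F u) - Real.log (F m)) / (u - m) ≤
        (Real.log (F m) - Real.log (F t)) / (m - t) := by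
    intro t ht hFt u hu
    have hFu : 0 < F u := hm.trans_le (hmono hu.le)
    have hut : 0 < u - t := by linarith
    have hum : 0 < u - m := by linarith
    have hmt : 0 < m - t := by linarith
    have h := hlc t u ((u - m) / (u - t)) ((m - t) / (u - t)) (by positivity) (by positivity)
      (by field_simp; ring)
    rw [show (u - m) / (u - t) * t + (m - t) / (u - t) * u = m by field_simp; ring] at h
    have h2 := Real.log_le_log (by positivity) h
    rw [Real.log_mul (by positivity) (by positivity), Real.log_rpow hFt, Real.log_rpow hFu] at h2
    rw [div_le_div_iff₀ hum hmt]
    have h3 := mul_le_mul_of_nonneg_left h2 hut.le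
    rw [show (u - t) * ((u - m) / (u - t) * Real.log (F t) + (m - t) / (u - t) * Real.log (F u)) =
      (u - m) * Real.log (F t) + (m - t) * Real.log (F u) by field_simp] at h3
    nlinarith
  -- The exponent is the supremum of the slopes of chords to the right of m. It is finite because
  -- the chord from `t₀` bounds them, and it supports log F at m from above on both sides.
  set S := (fun u => (Real.log (F u) - Real.log (F m)) / (u - m)) '' Set.Ioi m
  have hbdd : BddAbove S := ⟨_, by rintro _ ⟨u, hu, rfl⟩; exact slope t₀ ht₀ hF u hu⟩
  have hne : S.Nonempty := ⟨_, m + 1, by simp, rfl⟩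
  have hc : ∀ u, m < u → (Real.log (F u) - Real.log (F m)) / (u - m) ≤ sSup S :=
    fun u hu => le_csSup hbdd ⟨u, hu, rfl⟩
  refine ⟨sSup S, ?_, fun t => ?_⟩
  · refine le_trans (div_nonneg ?_ ?_) (hc (m + 1) (by linarith))
    · exact sub_nonneg.2 (Real.log_le_log hm (hmono (by linarith)))
    · linarith
  · rcases (h0 t).eq_or_lt with hFt | hFt
    · rw [← hFt]; positivity
    rw [← Real.log_le_log_iff hFt (by positivity), Real.log_mul hm.ne' (Real.exp_ne_zero _),
      Real.log_exp]
    rcases lt_trichotomy t m with h | rfl | h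
    · have : sSup S ≤ (Real.log (F m) - Real.log (F t)) / (m - t) :=
        csSup_le hne (by rintro _ ⟨u, hu, rfl⟩; exact slope t h hFt u hu)
      rw [le_div_iff₀ (by linarith)] at this
      linarith
    · simp
    · have := hc t h
      rw [div_le_iff₀ (by linarith)] at this
      linarith

/-- Grünbaum's inequality on the line: a probability measure with log-concave distribution function
gives mass at least `1/e` to the half-line below its mean. -/
theorem exp_neg_one_le_measureReal_Iic_mean (μ : Measure ℝ) [IsProbabilityMeasure μ]
    (hint : Integrable (fun x => x) μ)
    (hlc : ∀ s t a b : ℝ, 0 < a → 0 < b → a + b = 1 →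
      μ.real (Set.Iic s) ^ a * μ.real (Set.Iic t) ^ b ≤ μ.real (Set.Iic (a * s + b * t))) :
    Real.exp (-1) ≤ μ.real (Set.Iic (∫ x, x ∂μ)) := by
  set m := ∫ x, x ∂μ
  set F := fun t => μ.real (Set.Iic t)
  have hmono : Monotone F := fun s t hst => measureReal_mono (Set.Iic_subset_Iic.2 hst)
  have hconst : (∀ᵐ x ∂μ, m ≤ x) → ∀ᵐ x ∂μ, x = m := by
    intro h
    have h1 : ∫ x, (x - m) ∂μ = 0 := by
      rw [integral_sub hint (integrable_const _)]; simp [m]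
    have h2 : 0 ≤ᵐ[μ] fun x => x - m := by
      filter_upwards [h] with x hx
      simpa using hx
    filter_upwards [(integral_eq_zero_iff_of_nonneg_ae h2
      (hint.sub (integrable_const _))).1 h1] with x hx
    simpa [sub_eq_zero] using hx
  by_cases hcase : ∃ t₀, t₀ < m ∧ 0 < F t₀
  · obtain ⟨t₀, ht₀, hF⟩ := hcase
    obtain ⟨c, hc, hle⟩ := exists_le_mul_exp_of_logConcave hmono (fun t => measureReal_nonneg) hlc
      ht₀ hF
    have hm : 0 < F m := hF.trans_le (hmono ht₀.le)
    -- A flat majorant gives F ≤ F m everywhere; since F tends to one, F m = 1.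
    rcases hc.eq_or_lt with rfl | hc
    · have h1 : Filter.Tendsto F Filter.atTop (nhds 1) := by
        have := (ENNReal.tendsto_toReal (measure_ne_top μ Set.univ)).comp
          (tendsto_measure_Iic_atTop μ)
        rw [measure_univ, ENNReal.toReal_one] at this
        exact this
      have h2 : 1 ≤ F m := le_of_tendsto' h1 fun t => by simpa using hle t
      exact le_trans (Real.exp_le_one_iff.2 (by norm_num)) h2
    -- τ is the point where the exponential majorant reaches one. Comparing τ - m with the mean of
    -- the positive part of τ - x, which is at most the integral of exp(-cu) over u > 0, gives -log
    -- F(m) / c ≤ 1 / c.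
    · set τ := m - Real.log (F m) / c
      have hτ : τ - m ≤ 1 / c := by
        have i1 : Integrable (fun x => τ - x) μ := (integrable_const _).sub hint
        calc τ - m = ∫ x, (τ - x) ∂μ := by
              rw [integral_sub (integrable_const _) hint]; simp [m]
          _ ≤ ∫ x, max (τ - x) 0 ∂μ := integral_mono i1 i1.pos_part fun x => le_max_left _ _
          _ = ∫ u in Set.Ioi 0, μ.real {x | u < max (τ - x) 0} :=
              i1.pos_part.integral_eq_integral_meas_lt (ae_of_all _ fun x => le_max_right _ _)
          _ ≤ ∫ u in Set.Ioi 0, Real.exp (-c * u) := by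
              refine integral_mono_of_nonneg (ae_of_all _ fun u => measureReal_nonneg)
                (integrableOn_exp_mul_Ioi (by linarith) 0) ?_
              filter_upwards [ae_restrict_mem measurableSet_Ioi] with u hu
              rw [Set.mem_Ioi] at hu
              calc μ.real {x | u < max (τ - x) 0} ≤ F (τ - u) := by
                    refine measureReal_mono fun x hx => ?_
                    rcases lt_max_iff.1 (show u < max (τ - x) 0 from hx) with h | h
                    · simp only [Set.mem_Iic]; linarith
                    · linarith
                _ ≤ F m * Real.exp (c * (τ - u - m)) := hle _
                _ = Real.exp (-c * u) := by
                    have : c * (τ - u - m) = -Real.log (F m) + -c * u := by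
                      simp only [τ]; field_simp; ring
                    rw [this, Real.exp_add, Real.exp_neg, Real.exp_log hm, ← mul_assoc,
                      mul_inv_cancel₀ hm.ne', one_mul]
          _ = 1 / c := by
              rw [integral_exp_mul_Ioi (by linarith)]; simp
      have h3 : -1 ≤ Real.log (F m) := by
        have : τ - m = -Real.log (F m) / c := by simp only [τ]; ring
        rw [this, div_le_div_iff_of_pos_right hc] at hτ
        linarith
      exact (Real.le_log_iff_exp_le hm).1 h3
  -- No mass lies strictly below the mean, so the measure is concentrated at the mean.
  · push Not at hcase
    have h1 : μ (Set.Iio m) = 0 := by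
      have : Set.Iio m = ⋃ n : ℕ, Set.Iic (m - 1 / ((n : ℝ) + 1)) := by
        ext x
        simp only [Set.mem_Iio, Set.mem_iUnion, Set.mem_Iic]
        constructor
        · intro hx
          obtain ⟨n, hn⟩ := exists_nat_one_div_lt (sub_pos.2 hx)
          exact ⟨n, by linarith⟩
        · rintro ⟨n, hn⟩
          have : 0 < 1 / ((n : ℝ) + 1) := by positivity
          linarith
      rw [this, measure_iUnion_null_iff]
      intro n
      have h2 := hcase (m - 1 / ((n : ℝ) + 1)) (by
        have : 0 < 1 / ((n : ℝ) + 1) := by positivity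
        linarith)
      exact (measureReal_eq_zero_iff).1 (le_antisymm h2 measureReal_nonneg)
    have h2 : ∀ᵐ x ∂μ, x = m := hconst <| by
      have : ∀ᵐ x ∂μ, x ∉ Set.Iio m := measure_eq_zero_iff_ae_notMem.1 h1
      filter_upwards [this] with x hx
      simpa using hx
    have h3 : F m = 1 := by
      have : μ (Set.Iic m) = 1 := by
        rw [prob_compl_eq_zero_iff measurableSet_Iic |>.symm]
        refine measure_eq_zero_iff_ae_notMem.2 ?_
        filter_upwards [h2] with x hx
        simp [hx]
      simp [F, measureReal_def, this]
    change _ ≤ F m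
    rw [h3]
    exact Real.exp_le_one_iff.2 (by norm_num)

theorem integrable_linearMap_pi_gaussianReal {m : ℕ} (L : (Fin m → ℝ) →ₗ[ℝ] ℝ) :
    Integrable L (Measure.pi fun _ : Fin m => gaussianReal 0 1) := by
  have : (L : (Fin m → ℝ) → ℝ) = fun ξ => ∑ i, ξ i * L (Pi.single i 1) := by
    ext ξ
    rw [LinearMap.pi_apply_eq_sum_univ L ξ]
    refine Finset.sum_congr rfl fun i _ => ?_
    simp only [smul_eq_mul]
    congr 2
    ext j
    simp [Pi.single_apply, eq_comm]
  rw [this]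
  refine integrable_finsetSum _ fun i _ => Integrable.mul_const ?_ _
  exact integrable_eval (IsGaussian.integrable_id)

/-- Grünbaum's inequality for a standard Gaussian vector conditioned on a convex set, with
independent Gaussian noise added to a linear functional of it. -/
theorem exp_neg_one_mul_le_of_setIntegral_nonpos {m : ℕ} {C : Set (Fin m → ℝ)} (hC : Convex ℝ C)
    (hCm : MeasurableSet C) (L : (Fin m → ℝ) →ₗ[ℝ] ℝ) (s : ℝ)
    (hC0 : Measure.pi (fun _ : Fin m => gaussianReal 0 1) C ≠ 0)
    (hmean : ∫ ξ in C, L ξ ∂Measure.pi (fun _ : Fin m => gaussianReal 0 1) ≤ 0) :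
    ENNReal.ofReal (Real.exp (-1)) * Measure.pi (fun _ : Fin m => gaussianReal 0 1) C ≤
      ((Measure.pi fun _ : Fin m => gaussianReal 0 1).prod (gaussianReal 0 1))
        {p | p.1 ∈ C ∧ L p.1 + s * p.2 ≤ 0} := by
  set γ := Measure.pi fun _ : Fin m => gaussianReal 0 1
  have hLm : Measurable L := L.continuous_of_finiteDimensional.measurable
  set V : (Fin m → ℝ) × ℝ → ℝ := fun p => L p.1 + s * p.2
  have hV : Measurable V := by fun_prop
  have hlc : LogConcave fun t : ℝ => (γ.prod (gaussianReal 0 1)) {p | p.1 ∈ C ∧ V p ≤ t} := by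
    -- The threshold t enters the constraint linearly, so it can be treated as one more coordinate
    -- of a convex set. Integrating out the vector ξ and then the noise leaves a log-concave
    -- function of t.
    set K : Set ((ℝ × ℝ) × (Fin m → ℝ)) := {q | q.2 ∈ C ∧ L q.2 + s * q.1.2 ≤ q.1.1}
    have hK : Convex ℝ K := by
      intro p hp q hq a b ha hb hab
      refine ⟨hC hp.1 hq.1 ha hb hab, ?_⟩
      have h1 := mul_le_mul_of_nonneg_left hp.2 ha
      have h2 := mul_le_mul_of_nonneg_left hq.2 hb
      simp only [Prod.snd_add, Prod.smul_snd, Prod.fst_add, Prod.smul_fst, map_add, map_smul,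
        smul_eq_mul]
      linarith
    have hKm : MeasurableSet K :=
      (measurable_snd hCm).inter (measurableSet_le
        (f := fun q : (ℝ × ℝ) × (Fin m → ℝ) => L q.2 + s * q.1.2) (g := fun q => q.1.1)
        (by fun_prop) (by fun_prop))
    have hKi : Measurable (K.indicator (1 : (ℝ × ℝ) × (Fin m → ℝ) → ℝ≥0∞)) :=
      measurable_one.indicator hKm
    have h := ((logConcave_indicator_of_convex hK).lintegral_pi_gaussianReal
      hKi).lintegral_gaussianReal (Measurable.lintegral_prod_right hKi)
    convert h using 2 with t
    have hT : MeasurableSet {p | p.1 ∈ C ∧ V p ≤ t} :=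
      (measurable_fst hCm).inter (measurableSet_le hV measurable_const)
    rw [Measure.prod_apply_symm hT]
    refine lintegral_congr fun z => ?_
    have hs : MeasurableSet {ξ | ξ ∈ C ∧ L ξ + s * z ≤ t} :=
      hCm.inter (measurableSet_le (f := fun ξ => L ξ + s * z) (g := fun _ => t)
        (by fun_prop) (by fun_prop))
    exact (lintegral_indicator_one hs).symm
  have : IsProbabilityMeasure (cond γ C) := cond_isProbabilityMeasure hC0
  set μ := ((cond γ C).prod (gaussianReal 0 1)).map V
  have : IsProbabilityMeasure μ := Measure.isProbabilityMeasure_map hV.aemeasurable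
  have hprod : (cond γ C).prod (gaussianReal 0 1) =
      (γ C)⁻¹ • (γ.restrict C).prod (gaussianReal 0 1) := by
    rw [ProbabilityTheory.cond, Measure.prod_smul_left]
  have hμ : ∀ t, μ (Set.Iic t) = (γ C)⁻¹ * (γ.prod (gaussianReal 0 1)) {p | p.1 ∈ C ∧ V p ≤ t} := by
    intro t
    rw [Measure.map_apply hV measurableSet_Iic, hprod, Measure.smul_apply, smul_eq_mul]
    congr 1
    have : (γ.restrict C).prod (gaussianReal 0 1) =
        (γ.prod (gaussianReal 0 1)).restrict (C ×ˢ Set.univ) := by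
      rw [← Measure.prod_restrict, Measure.restrict_univ]
    rw [this, Measure.restrict_apply (hV measurableSet_Iic)]
    congr 1
    ext p
    simp [and_comm]
  have hinv0 : (γ C)⁻¹ ≠ 0 := by simp [measure_ne_top]
  have hinvt : (γ C)⁻¹ ≠ ⊤ := by simpa using hC0
  have hL : Integrable L (cond γ C) :=
    ((integrable_linearMap_pi_gaussianReal L).restrict).smul_measure hinvt
  have hz : Integrable (fun z : ℝ => z) (gaussianReal 0 1) := IsGaussian.integrable_id
  have i1 : Integrable (fun p : (Fin m → ℝ) × ℝ => L p.1) ((cond γ C).prod (gaussianReal 0 1)) :=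
    hL.comp_fst _
  have i2 : Integrable (fun p : (Fin m → ℝ) × ℝ => s * p.2)
      ((cond γ C).prod (gaussianReal 0 1)) := (hz.comp_snd _).const_mul s
  have hVint : Integrable V ((cond γ C).prod (gaussianReal 0 1)) := i1.add i2
  have hid : Integrable (fun x => x) μ :=
    (integrable_map_measure (by fun_prop) hV.aemeasurable).2 hVint
  have hm : ∫ x, x ∂μ ≤ 0 := by
    rw [integral_map hV.aemeasurable (by fun_prop)]
    simp only [V]
    rw [integral_add i1 i2, integral_fun_fst, integral_const_mul,
      integral_fun_snd (μ := γ[|C]) (ν := gaussianReal 0 1) (fun z : ℝ => z)]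
    simp only [probReal_univ, one_smul, integral_id_gaussianReal, mul_zero, add_zero]
    rw [ProbabilityTheory.cond, integral_smul_measure]
    exact mul_nonpos_of_nonneg_of_nonpos ENNReal.toReal_nonneg hmean
  have hG := exp_neg_one_le_measureReal_Iic_mean μ hid (fun u t a b ha hb hab => by
    have h := hlc u t a b ha hb hab
    have h' : μ (Set.Iic u) ^ a * μ (Set.Iic t) ^ b ≤ μ (Set.Iic (a * u + b * t)) := by
      rw [hμ, hμ, hμ, ENNReal.mul_rpow_of_nonneg _ _ ha.le, ENNReal.mul_rpow_of_nonneg _ _ hb.le,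
        mul_mul_mul_comm, ← ENNReal.rpow_add _ _ hinv0 hinvt, hab, ENNReal.rpow_one]
      gcongr
      exact h
    rw [measureReal_def, measureReal_def, measureReal_def, ENNReal.toReal_rpow,
      ENNReal.toReal_rpow, ← ENNReal.toReal_mul]
    exact ENNReal.toReal_mono (measure_ne_top _ _) h')
  have hG2 : ENNReal.ofReal (Real.exp (-1)) ≤ μ (Set.Iic 0) := by
    rw [← ofReal_measureReal]
    exact ENNReal.ofReal_le_ofReal (hG.trans (measureReal_mono (Set.Iic_subset_Iic.2 hm)))
  rw [hμ] at hG2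
  calc _ ≤ (γ C)⁻¹ * (γ.prod (gaussianReal 0 1)) {p | p.1 ∈ C ∧ V p ≤ 0} * γ C := by gcongr
    _ = _ := by
      rw [mul_comm, ← mul_assoc, ENNReal.mul_inv_cancel hC0 (measure_ne_top _ _), one_mul]

open scoped MatrixOrder Matrix.Norms.L2Operator

/-! ### Finite-dimensional Gaussian process samples and Gaussian regression -/

section GaussianProcess

variable {𝒳 ι : Type*}

/-- The Gram matrix of a finite family of inputs. -/
def gram (k : 𝒳 → 𝒳 → ℝ) (x : ι → 𝒳) : Matrix ι ι ℝ := Matrix.of fun i j => k (x i) (x j)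

theorem gram_posSemidef {k : 𝒳 → 𝒳 → ℝ} (hk : (Matrix.of k : Matrix 𝒳 𝒳 ℝ).PosSemidef)
    (x : ι → 𝒳) : (gram k x).PosSemidef :=
  hk.submatrix x

variable [Fintype ι] [DecidableEq ι]

/-- The values at a finite family of inputs of the Gaussian process driven by the noise `ξ`. -/
noncomputable def gpSample (k : 𝒳 → 𝒳 → ℝ) (x : ι → 𝒳) (ξ : EuclideanSpace ℝ ι) :
    EuclideanSpace ℝ ι :=
  Matrix.toEuclideanCLM (𝕜 := ℝ) (CFC.sqrt (gram k x)) ξ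

theorem map_gpSample (k : 𝒳 → 𝒳 → ℝ) (x : ι → 𝒳) :
    (stdGaussian (EuclideanSpace ℝ ι)).map (gpSample k x) =
      multivariateGaussian 0 (gram k x) := by
  simp only [multivariateGaussian, zero_add]
  rfl

theorem measurable_gpSample_left (k : 𝒳 → 𝒳 → ℝ) (x : ι → 𝒳) : Measurable (gpSample k x) := by
  unfold gpSample
  fun_prop

/-- The matrix square root is continuous on positive semidefinite matrices, hence measurable in the
inputs. Joint measurability is what allows Tonelli when the inputs themselves are random. -/
theorem measurable_gpSample [MeasurableSpace 𝒳] {k : 𝒳 → 𝒳 → ℝ}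
    (hk_meas : Measurable (Function.uncurry k)) (hk : (Matrix.of k : Matrix 𝒳 𝒳 ℝ).PosSemidef) :
    Measurable fun p : (ι → 𝒳) × EuclideanSpace ℝ ι => gpSample k p.1 p.2 := by
  have hsqrt : ∀ i j, Measurable fun x : ι → 𝒳 => CFC.sqrt (gram k x) i j := by
    intro i j
    let _ : MeasurableSpace (Matrix ι ι ℝ) := inferInstanceAs (MeasurableSpace (ι → ι → ℝ))
    have : BorelSpace (Matrix ι ι ℝ) := inferInstanceAs (BorelSpace (ι → ι → ℝ))
    have hc : Continuous fun A : {A : Matrix ι ι ℝ // 0 ≤ A} => CFC.sqrt A.1 i j := by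
      have h := (CFC.continuousOn_sqrt (A := Matrix ι ι ℝ)).domRestrict
      exact (continuous_apply_apply i j).comp h
    have hg : Measurable fun x : ι → 𝒳 =>
        (⟨gram k x, (gram_posSemidef hk x).nonneg⟩ : {A : Matrix ι ι ℝ // 0 ≤ A}) := by
      refine Measurable.subtype_mk ?_
      refine measurable_pi_lambda _ fun i => measurable_pi_lambda _ fun j => ?_
      exact (hk_meas.comp ((measurable_pi_apply i).prodMk (measurable_pi_apply j)) :
        Measurable fun x : ι → 𝒳 => Function.uncurry k (x i, x j))
    exact hc.measurable.comp hg
  have : (fun p : (ι → 𝒳) × EuclideanSpace ℝ ι => gpSample k p.1 p.2) =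
      fun p => WithLp.toLp 2 fun i => ∑ j, CFC.sqrt (gram k p.1) i j * p.2 j := by
    ext p i
    rw [gpSample, Matrix.ofLp_toEuclideanCLM]
    rfl
  rw [this]
  refine (WithLp.measurable_toLp 2 _).comp (measurable_pi_lambda _ fun i => ?_)
  refine Finset.measurable_sum _ fun j _ => ?_
  exact ((hsqrt i j).comp measurable_fst).mul
    ((by fun_prop : Measurable fun v : EuclideanSpace ℝ ι => v j).comp measurable_snd)

theorem memLp_eval_multivariateGaussian (S : Matrix ι ι ℝ) (i : ι) :
    MemLp (fun v : EuclideanSpace ℝ ι => v i) 2 (multivariateGaussian 0 S) := by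
  have h : MemLp (fun v : EuclideanSpace ℝ ι => v) 2 (multivariateGaussian 0 S) :=
    IsGaussian.memLp_two_id
  exact (EuclideanSpace.proj i : EuclideanSpace ℝ ι →L[ℝ] ℝ).comp_memLp' h

theorem integral_eval_multivariateGaussian (S : Matrix ι ι ℝ) (i : ι) :
    ∫ v : EuclideanSpace ℝ ι, v i ∂multivariateGaussian 0 S = 0 := by
  have h := ContinuousLinearMap.integral_comp_id_comm (μ := multivariateGaussian 0 S)
    (IsGaussian.integrable_id) (EuclideanSpace.proj i : EuclideanSpace ℝ ι →L[ℝ] ℝ)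
  simpa using h

/-- Coordinate projections and reindexings of centred multivariate Gaussians. -/
theorem map_comp_multivariateGaussian {κ : Type*} [Fintype κ] [DecidableEq κ]
    {S : Matrix ι ι ℝ} (hS : S.PosSemidef) (e : κ → ι) :
    (multivariateGaussian 0 S).map (fun v => WithLp.toLp 2 fun j => v (e j)) =
      multivariateGaussian 0 (S.submatrix e e) := by
  have hL : ∃ L : EuclideanSpace ℝ ι →L[ℝ] EuclideanSpace ℝ κ,
      ∀ v, L v = WithLp.toLp 2 fun j => v (e j) := by
    refine ⟨LinearMap.toContinuousLinearMap
      { toFun := fun v => WithLp.toLp 2 fun j => v (e j), map_add' := ?_, map_smul' := ?_ },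
      fun v => rfl⟩
    · intro v w; ext j; simp
    · intro c v; ext j; simp
  obtain ⟨L, hL⟩ := hL
  have hmeas : Measurable fun v : EuclideanSpace ℝ ι =>
      (WithLp.toLp 2 fun j => v (e j) : EuclideanSpace ℝ κ) := by
    exact (funext hL : ⇑L = _) ▸ L.continuous.measurable
  rw [show (fun v : EuclideanSpace ℝ ι => (WithLp.toLp 2 fun j => v (e j) : EuclideanSpace ℝ κ)) = L
    from funext fun v => (hL v).symm]
  apply IsGaussian.ext
  · simp only [id_eq, integral_id_multivariateGaussian]
    rw [ContinuousLinearMap.integral_id_map, integral_id_multivariateGaussian, map_zero]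
    exact IsGaussian.integrable_id
  rw [← ContinuousLinearMap.toBilinForm_inj]
  refine LinearMap.BilinForm.ext_basis (EuclideanSpace.basisFun κ ℝ).toBasis fun i j => ?_
  rw [ContinuousLinearMap.toBilinForm_apply, ContinuousLinearMap.toBilinForm_apply,
    covarianceBilin_apply_eq_cov, covariance_map]
  · have (i : κ) : (fun u => inner ℝ ((EuclideanSpace.basisFun κ ℝ).toBasis i) u) ∘ L =
        fun u => u (e i) := by
      ext u; simp [PiLp.inner_apply, hL]
    simp_rw [this, covariance_eval_multivariateGaussian hS,
      covarianceBilin_multivariateGaussian (hS.submatrix _)]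
    simp
  any_goals exact Measurable.aestronglyMeasurable (by fun_prop)
  · fun_prop
  · exact IsGaussian.memLp_two_id

/-- The regression coefficients of a Gaussian vector with covariance `S` at the coordinate `p` on
the coordinates `e`. -/
noncomputable def regressionVec {κ : Type*} [Fintype κ] [DecidableEq κ] (S : Matrix ι ι ℝ)
    (e : κ → ι) (p : ι) : κ → ℝ :=
  (S.submatrix e e)⁻¹ *ᵥ fun j => S p (e j)

/-- Gaussian regression: the residual is independent of the regressors. -/
theorem map_residual_multivariateGaussian {κ : Type*} [Fintype κ] [DecidableEq κ]
    {S : Matrix ι ι ℝ} (hS : S.PosSemidef) (e : κ → ι) (p : ι)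
    (hu : IsUnit (S.submatrix e e)) :
    (multivariateGaussian 0 S).map (fun v => ((WithLp.toLp 2 fun j => v (e j) :
        EuclideanSpace ℝ κ), v p - regressionVec S e p ⬝ᵥ fun j => v (e j))) =
      (multivariateGaussian 0 (S.submatrix e e)).prod
        (gaussianReal 0 (S p p - regressionVec S e p ⬝ᵥ fun j => S p (e j)).toNNReal) := by
  set a := regressionVec S e p with ha
  set P := multivariateGaussian 0 S
  set R : EuclideanSpace ℝ ι → ℝ := fun v => v p - a ⬝ᵥ fun j => v (e j)
  have hmem : ∀ i, MemLp (fun v : EuclideanSpace ℝ ι => v i) 2 P :=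
    fun i => memLp_eval_multivariateGaussian S i
  have hsum : MemLp (fun v : EuclideanSpace ℝ ι => ∑ j, a j * v (e j)) 2 P :=
    memLp_finsetSum _ fun j _ => (hmem (e j)).const_mul _
  have hcov : ∀ i, cov[R, fun v => v i; P] = S p i - a ⬝ᵥ fun j => S (e j) i := by
    intro i
    simp only [R, dotProduct]
    rw [covariance_fun_sub_left (hmem p) hsum (hmem i), covariance_eval_multivariateGaussian hS,
      covariance_fun_sum_left (fun j => (hmem (e j)).const_mul _) (hmem i)]
    simp_rw [covariance_const_mul_left, P, covariance_eval_multivariateGaussian hS]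
  have hsymm : ∀ i j, S i j = S j i := fun i j => by
    simpa using (hS.isHermitian.apply i j).symm
  -- These are the normal equations: the regression vector solves the linear system of the
  -- covariance block of the regressors.
  have hzero : ∀ j, cov[R, fun v => v (e j); P] = 0 := by
    intro j
    rw [hcov, sub_eq_zero]
    have h : (S.submatrix e e) *ᵥ a = fun j => S p (e j) := by
      rw [ha, regressionVec, Matrix.mulVec_mulVec, Matrix.mul_nonsing_inv _
        ((Matrix.isUnit_iff_isUnit_det _).1 hu), Matrix.one_mulVec]
    rw [← congrFun h j, Matrix.mulVec, dotProduct_comm]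
    congr 1
    ext i
    exact hsymm _ _
  have hRm : MemLp R 2 P := (hmem p).sub hsum
  have hvar : Var[R; P] = S p p - a ⬝ᵥ fun j => S p (e j) := by
    rw [← covariance_self hRm.aemeasurable]
    conv_lhs =>
      arg 2
      simp only [R, dotProduct]
    rw [covariance_fun_sub_right hRm (hmem p) hsum,
      covariance_fun_sum_right (fun j => (hmem (e j)).const_mul _) hRm]
    simp_rw [covariance_const_mul_right, hzero]
    rw [hcov]
    simp [hsymm p]
  have hmean : ∫ v, R v ∂P = 0 := by
    simp only [R, dotProduct]
    rw [integral_sub ((hmem p).integrable one_le_two) (hsum.integrable one_le_two),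
      integral_finsetSum _ fun j _ => ((hmem (e j)).const_mul _).integrable one_le_two]
    simp [integral_const_mul, P, integral_eval_multivariateGaussian]
  obtain ⟨L, hL⟩ : ∃ L : EuclideanSpace ℝ ι →L[ℝ] (κ → ℝ) × (Unit → ℝ),
      ∀ v, L v = (fun j => v (e j), fun _ => R v) := by
    refine ⟨LinearMap.toContinuousLinearMap
      { toFun := fun v => (fun j => v (e j), fun _ => R v), map_add' := ?_, map_smul' := ?_ },
      fun v => rfl⟩
    · intro v w
      ext j
      · simp
      · simp [R, dotProduct, mul_add, Finset.sum_add_distrib]; ring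
    · intro c v
      ext j
      · simp
      · simp [R, dotProduct, mul_left_comm, mul_sub, Finset.mul_sum]
  -- Regressors and residual are together a linear image of one Gaussian vector, so vanishing
  -- covariance implies independence.
  have hgauss : HasGaussianLaw (fun v : EuclideanSpace ℝ ι =>
      ((fun j => v (e j) : κ → ℝ), (fun _ => R v : Unit → ℝ))) P := by
    have h := (IsGaussian.hasGaussianLaw_id (μ := P)).map_fun L
    simpa only [id, hL] using h
  have hind := hgauss.indepFun_of_covariance_eval (X := fun j v => v (e j))
    (Y := fun (_ : Unit) v => R v) fun i j => by rw [covariance_comm]; exact hzero i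
  have hind2 : IndepFun (fun v => (WithLp.toLp 2 fun j => v (e j) : EuclideanSpace ℝ κ)) R P :=
    hind.comp (φ := WithLp.toLp 2) (ψ := fun y : Unit → ℝ => y ()) (by fun_prop) (by fun_prop)
  have hm1 : Measurable fun v : EuclideanSpace ℝ ι =>
      (WithLp.toLp 2 fun j => v (e j) : EuclideanSpace ℝ κ) := by fun_prop
  rw [(indepFun_iff_map_prod_eq_prod_map_map hm1.aemeasurable hRm.aemeasurable).1 hind2,
    map_comp_multivariateGaussian hS]
  congr 1
  have hR : HasGaussianLaw R P := hgauss.snd.eval ()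
  rw [hR.map_eq_gaussianReal, hmean, hvar]

end GaussianProcess

/-! ### Ghost samples, exchangeability and the exceptional event -/

section Ghost

/-- Indices of a sample with `l` ghost points attached to each training point `(i, none)`. -/
abbrev GhostIndex (n l : ℕ) : Type := Fin n × Option (Fin l)

/-- The indices of training points and of ghost points. -/
def ghostEquiv (n l : ℕ) : GhostIndex n l ≃ Fin n ⊕ (Fin n × Fin l) where
  toFun p := p.2.elim (Sum.inl p.1) fun j => Sum.inr (p.1, j)
  invFun := Sum.elim (fun i => (i, none)) fun q => (q.1, some q.2)
  left_inv := by rintro ⟨i, _ | j⟩ <;> rfl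
  right_inv := by rintro (i | ⟨i, j⟩) <;> rfl

/-- The full sample made of a training sample and a ghost sample. -/
def withGhosts {E : Type*} {n l : ℕ} (S : Fin n → E) (T : Fin n × Fin l → E) :
    GhostIndex n l → E :=
  fun p => Sum.elim S T (ghostEquiv n l p)

theorem lintegral_withGhosts {E : Type*} [MeasurableSpace E] {D : Measure E}
    [IsProbabilityMeasure D] {n l : ℕ} {F : (GhostIndex n l → E) → ℝ≥0∞} (hF : Measurable F) :
    ∫⁻ Z, F Z ∂Measure.pi (fun _ => D) =
      ∫⁻ S, ∫⁻ T, F (withGhosts S T) ∂Measure.pi (fun _ => D) ∂Measure.pi (fun _ => D) := by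
  have h1 := measurePreserving_piCongrLeft (fun _ : GhostIndex n l => D) (ghostEquiv n l).symm
  have h2 := (measurePreserving_sumPiEquivProdPi
    (fun _ : Fin n ⊕ (Fin n × Fin l) => D)).symm
  have h := h1.comp h2
  rw [← h.lintegral_comp hF, lintegral_prod (fun a => F ((_ ∘ _) a))
    (hF.comp h.measurable).aemeasurable]
  refine lintegral_congr fun S => lintegral_congr fun T => ?_
  congr 1
  ext p : 1
  obtain ⟨q, rfl⟩ := (ghostEquiv n l).symm.surjective p
  simp only [Function.comp_apply]
  rw [MeasurableEquiv.piCongrLeft_apply_apply]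
  rcases q with i | q <;> rfl

/-- Reciprocal of the fraction of correct points in group `i`. -/
noncomputable def groupWeight {n l : ℕ} (u : GhostIndex n l → ℝ) (i : Fin n) : ℝ :=
  ((l : ℝ) + 1) / ∑ o, u (i, o)

/-- Importance weight of a consistent predictor with correctness indicators `u`. -/
noncomputable def ghostWeight {n l : ℕ} (u : GhostIndex n l → ℝ) : ℝ :=
  ∏ i, u (i, none) * groupWeight u i

/-- Exchange of each training point with a chosen point of its group. -/
def ghostSwap {n l : ℕ} (c : Fin n → Option (Fin l)) : Equiv.Perm (GhostIndex n l) where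
  toFun p := (p.1, Equiv.swap none (c p.1) p.2)
  invFun p := (p.1, Equiv.swap none (c p.1) p.2)
  left_inv p := by simp
  right_inv p := by simp

theorem ghostWeight_nonneg {n l : ℕ} {u : GhostIndex n l → ℝ} (hu : ∀ p, 0 ≤ u p) :
    0 ≤ ghostWeight u :=
  Finset.prod_nonneg fun i _ => mul_nonneg (hu _)
    (div_nonneg (by positivity) (Finset.sum_nonneg fun o _ => hu _))

/-- A swap changes which point of a group is tested but not the sum over the group. The sum over all
choices therefore factors into one factor per group, in which the correct points cancel the
denominator. -/
theorem sum_ghostWeight_le {n l : ℕ} {u : GhostIndex n l → ℝ} (hu : ∀ p, 0 ≤ u p) :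
    ∑ c : Fin n → Option (Fin l), ghostWeight (u ∘ ghostSwap c) ≤ ((l : ℝ) + 1) ^ n := by
  have h : ∀ c : Fin n → Option (Fin l),
      ghostWeight (u ∘ ghostSwap c) = ∏ i, u (i, c i) * groupWeight u i := by
    intro c
    refine Finset.prod_congr rfl fun i _ => ?_
    have h1 : (u ∘ ghostSwap c) (i, none) = u (i, c i) := by simp [ghostSwap]
    have h2 : groupWeight (u ∘ ghostSwap c) i = groupWeight u i := by
      unfold groupWeight
      congr 1
      exact Equiv.sum_comp (Equiv.swap none (c i)) fun o => u (i, o)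
    rw [h1, h2]
  have h2 := Finset.prod_univ_sum (fun _ : Fin n => (Finset.univ : Finset (Option (Fin l))))
    fun i o => u (i, o) * groupWeight u i
  rw [Fintype.piFinset_univ] at h2
  simp_rw [h, ← h2]
  calc _ ≤ ∏ _i : Fin n, ((l : ℝ) + 1) := by
        refine Finset.prod_le_prod (fun i _ => Finset.sum_nonneg fun o _ => mul_nonneg (hu _)
          (div_nonneg (by positivity) (Finset.sum_nonneg fun o _ => hu _))) fun i _ => ?_
        rw [← Finset.sum_mul, groupWeight]
        -- A group without correct points has weight zero by the convention x / 0 = 0, and its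
        -- factor is then 0 rather than l + 1.
        by_cases h0 : ∑ o, u (i, o) = 0
        · rw [h0]; simp; positivity
        · rw [mul_div_cancel₀ _ h0]
    _ = _ := by simp

variable {𝒳 : Type*} {ι : Type*} [Fintype ι] [DecidableEq ι]

open Classical in
/-- Correctness indicators of the Gaussian process on a labelled sample. -/
noncomputable def correct (k : 𝒳 → 𝒳 → ℝ) (Z : ι → 𝒳 × Label) (ω : EuclideanSpace ℝ ι)
    (p : ι) : ℝ :=
  if Real.sign (gpSample k (fun p => (Z p).1) ω p) = (Z p).2 then 1 else 0

theorem correct_nonneg (k : 𝒳 → 𝒳 → ℝ) (Z : ι → 𝒳 × Label) (ω : EuclideanSpace ℝ ι) (p : ι) :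
    0 ≤ correct k Z ω p := by
  unfold correct; split_ifs <;> simp

theorem correct_le_one (k : 𝒳 → 𝒳 → ℝ) (Z : ι → 𝒳 × Label) (ω : EuclideanSpace ℝ ι) (p : ι) :
    correct k Z ω p ≤ 1 := by
  unfold correct; split_ifs <;> simp

theorem measurable_sign : Measurable Real.sign := by
  have : Real.sign = fun r : ℝ => if r < 0 then -1 else if 0 < r then 1 else 0 := by
    ext r; rfl
  rw [this]
  exact Measurable.ite measurableSet_Iio measurable_const
    (Measurable.ite measurableSet_Ioi measurable_const measurable_const)

theorem measurable_ghostWeight {n l : ℕ} :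
    Measurable (ghostWeight : (GhostIndex n l → ℝ) → ℝ) := by
  unfold ghostWeight groupWeight
  fun_prop

variable {k : 𝒳 → 𝒳 → ℝ}

/-- Permuting the inputs permutes the covariance matrix, so the process values are permuted in law.
The equality holds after integrating over the noise, not for a fixed noise vector. -/
theorem lintegral_correct_comp (hk : (Matrix.of k : Matrix 𝒳 𝒳 ℝ).PosSemidef)
    (Z : ι → 𝒳 × Label) (σ : Equiv.Perm ι) {F : (ι → ℝ) → ℝ≥0∞} (hF : Measurable F) :
    ∫⁻ ω, F (correct k (Z ∘ σ) ω) ∂stdGaussian (EuclideanSpace ℝ ι) =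
      ∫⁻ ω, F (correct k Z ω ∘ σ) ∂stdGaussian (EuclideanSpace ℝ ι) := by
  classical
  set G : EuclideanSpace ℝ ι → ℝ≥0∞ := fun v =>
    F fun p => if Real.sign (v p) = (Z (σ p)).2 then 1 else 0
  have hG : Measurable G := by
    refine hF.comp (measurable_pi_lambda _ fun p => ?_)
    exact Measurable.ite (measurableSet_eq_fun (measurable_sign.comp (by fun_prop))
      measurable_const) measurable_const measurable_const
  have hσ : Measurable fun v : EuclideanSpace ℝ ι =>
      (WithLp.toLp 2 fun j => v (σ j) : EuclideanSpace ℝ ι) := by fun_prop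
  calc _ = ∫⁻ ω, G (gpSample k (fun p => (Z (σ p)).1) ω) ∂stdGaussian (EuclideanSpace ℝ ι) := by
        refine lintegral_congr fun ω => ?_
        simp only [G]
        congr 1
    _ = ∫⁻ v, G v ∂multivariateGaussian 0 (gram k fun p => (Z (σ p)).1) := by
        rw [← map_gpSample, lintegral_map hG (measurable_gpSample_left _ _)]
    _ = ∫⁻ v, G (WithLp.toLp 2 fun j => v (σ j))
          ∂multivariateGaussian 0 (gram k fun p => (Z p).1) := by
        rw [← lintegral_map hG hσ, map_comp_multivariateGaussian (gram_posSemidef hk _)]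
        rfl
    _ = _ := by
        rw [← map_gpSample, lintegral_map (f := fun v => G (WithLp.toLp 2 fun j => v (σ j)))
          (hG.comp hσ) (measurable_gpSample_left _ _)]
        refine lintegral_congr fun ω => ?_
        simp only [G]
        congr 1

variable [MeasurableSpace 𝒳]

theorem measurable_correct (hk_meas : Measurable (Function.uncurry k))
    (hk : (Matrix.of k : Matrix 𝒳 𝒳 ℝ).PosSemidef) :
    Measurable fun q : (ι → 𝒳 × Label) × EuclideanSpace ℝ ι => correct k q.1 q.2 := by
  refine measurable_pi_lambda _ fun p => ?_
  have h1 : Measurable fun q : (ι → 𝒳 × Label) × EuclideanSpace ℝ ι =>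
      gpSample k (fun p => (q.1 p).1) q.2 p := by
    have h := (measurable_gpSample (ι := ι) hk_meas hk).comp
      (f := fun q : (ι → 𝒳 × Label) × EuclideanSpace ℝ ι => (fun p => (q.1 p).1, q.2))
      (by fun_prop)
    exact (by fun_prop : Measurable fun v : EuclideanSpace ℝ ι => v p).comp h
  have h2 : Measurable fun q : (ι → 𝒳 × Label) × EuclideanSpace ℝ ι => ((q.1 p).2 : ℝ) := by
    fun_prop
  exact Measurable.ite (measurableSet_eq_fun (measurable_sign.comp h1) h2) measurable_const
    measurable_const

variable (D : Measure (𝒳 × Label)) [IsProbabilityMeasure D]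

/-- All points of the full sample are iid and the process is permutation-equivariant in law, so
every swap gives the same mean weight. Averaging over the (l + 1)^n swaps and applying
`sum_ghostWeight_le` pointwise bounds that common value. -/
theorem lintegral_ghostWeight_le_one (hk_meas : Measurable (Function.uncurry k))
    (hk : (Matrix.of k : Matrix 𝒳 𝒳 ℝ).PosSemidef) (n l : ℕ) :
    ∫⁻ Z, ∫⁻ ω, ENNReal.ofReal (ghostWeight (correct k Z ω))
      ∂stdGaussian (EuclideanSpace ℝ (GhostIndex n l)) ∂Measure.pi (fun _ => D) ≤ 1 := by
  set I := ∫⁻ Z, ∫⁻ ω, ENNReal.ofReal (ghostWeight (correct k Z ω))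
      ∂stdGaussian (EuclideanSpace ℝ (GhostIndex n l)) ∂Measure.pi (fun _ => D) with hI
  have hmeas : ∀ σ : Equiv.Perm (GhostIndex n l), Measurable fun q :
      (GhostIndex n l → 𝒳 × Label) × EuclideanSpace ℝ (GhostIndex n l) =>
      ENNReal.ofReal (ghostWeight (correct k q.1 q.2 ∘ σ)) := by
    intro σ
    have h := measurable_correct (ι := GhostIndex n l) hk_meas hk
    refine ENNReal.measurable_ofReal.comp (measurable_ghostWeight.comp
      (measurable_pi_lambda _ fun p => ?_))
    exact (measurable_pi_apply (σ p)).comp h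
  have hperm : ∀ σ : Equiv.Perm (GhostIndex n l),
      ∫⁻ Z, ∫⁻ ω, ENNReal.ofReal (ghostWeight (correct k Z ω ∘ σ))
        ∂stdGaussian (EuclideanSpace ℝ (GhostIndex n l)) ∂Measure.pi (fun _ => D) = I := by
    intro σ
    have h1 := (measurePreserving_piCongrLeft (fun _ : GhostIndex n l => D) σ).symm
    rw [hI, ← h1.lintegral_comp (f := fun Z => ∫⁻ ω, ENNReal.ofReal (ghostWeight (correct k Z ω))
      ∂stdGaussian (EuclideanSpace ℝ (GhostIndex n l)))
      (Measurable.lintegral_prod_right (hmeas (Equiv.refl _)))]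
    refine lintegral_congr fun Z => ?_
    rw [← lintegral_correct_comp hk Z σ (F := fun u => ENNReal.ofReal (ghostWeight u))
      (ENNReal.measurable_ofReal.comp measurable_ghostWeight)]
    rfl
  have hsum : ∑ _c : Fin n → Option (Fin l), I ≤ ENNReal.ofReal (((l : ℝ) + 1) ^ n) := by
    calc ∑ _c : Fin n → Option (Fin l), I
        = ∑ c : Fin n → Option (Fin l),
          ∫⁻ Z, ∫⁻ ω, ENNReal.ofReal (ghostWeight (correct k Z ω ∘ ghostSwap c))
          ∂stdGaussian (EuclideanSpace ℝ (GhostIndex n l)) ∂Measure.pi (fun _ => D) :=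
          Finset.sum_congr rfl fun c _ => (hperm _).symm
      _ = ∫⁻ Z, ∫⁻ ω, ∑ c : Fin n → Option (Fin l),
            ENNReal.ofReal (ghostWeight (correct k Z ω ∘ ghostSwap c))
          ∂stdGaussian (EuclideanSpace ℝ (GhostIndex n l)) ∂Measure.pi (fun _ => D) := by
          rw [← lintegral_finsetSum _ fun c _ => Measurable.lintegral_prod_right (hmeas _)]
          refine lintegral_congr fun Z => ?_
          exact (lintegral_finsetSum _ fun c _ => (hmeas (ghostSwap c)).comp
            measurable_prodMk_left).symm
      _ ≤ ∫⁻ Z : GhostIndex n l → 𝒳 × Label, ∫⁻ ω, ENNReal.ofReal (((l : ℝ) + 1) ^ n)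
          ∂stdGaussian (EuclideanSpace ℝ (GhostIndex n l)) ∂Measure.pi (fun _ => D) := by
          refine lintegral_mono fun Z => lintegral_mono fun ω => ?_
          simp only
          rw [← ENNReal.ofReal_sum_of_nonneg fun c _ =>
            ghostWeight_nonneg (u := correct k Z ω ∘ ghostSwap c) fun p => correct_nonneg _ _ _ _]
          exact ENNReal.ofReal_le_ofReal (sum_ghostWeight_le fun p => correct_nonneg _ _ _ _)
      _ = _ := by simp
  rw [Finset.sum_const, Finset.card_univ, Fintype.card_fun, Fintype.card_option, Fintype.card_fin,
    Fintype.card_fin, nsmul_eq_mul, show ((l : ℝ) + 1) ^ n = (((l + 1) ^ n : ℕ) : ℝ) by push_cast; rfl,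
    ENNReal.ofReal_natCast] at hsum
  have h0 : (((l + 1) ^ n : ℕ) : ℝ≥0∞) ≠ 0 := by simp
  have := (ENNReal.mul_le_mul_iff_right (b := I) (c := 1) h0 (ENNReal.natCast_ne_top _)).1
    (by simpa using hsum)
  exact this

/-- Average over ghost samples and over the Gaussian process prior of the importance weight. -/
noncomputable def ghostMass (k : 𝒳 → 𝒳 → ℝ) (D : Measure (𝒳 × Label)) {n : ℕ} (l : ℕ)
    (S : Fin n → 𝒳 × Label) : ℝ≥0∞ :=
  ∫⁻ T, ∫⁻ ω, ENNReal.ofReal (ghostWeight (correct k (withGhosts S T) ω))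
      ∂stdGaussian (EuclideanSpace ℝ (GhostIndex n l)) ∂Measure.pi (fun _ => D)

theorem measurable_withGhosts {E : Type*} [MeasurableSpace E] {n l : ℕ} :
    Measurable fun q : (Fin n → E) × (Fin n × Fin l → E) => withGhosts q.1 q.2 := by
  refine measurable_pi_lambda _ ?_
  rintro ⟨i, _ | j⟩
  · exact (measurable_pi_apply i).comp measurable_fst
  · exact (measurable_pi_apply (i, j)).comp measurable_snd

theorem measurable_ghostWeight_correct (hk_meas : Measurable (Function.uncurry k))
    (hk : (Matrix.of k : Matrix 𝒳 𝒳 ℝ).PosSemidef) {n l : ℕ} :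
    Measurable fun q : (GhostIndex n l → 𝒳 × Label) × EuclideanSpace ℝ (GhostIndex n l) =>
      ENNReal.ofReal (ghostWeight (correct k q.1 q.2)) :=
  ENNReal.measurable_ofReal.comp (measurable_ghostWeight.comp (measurable_correct hk_meas hk))

/-- Markov's inequality. The event does not mention a posterior, so posteriors may later be chosen
in terms of the whole training sample. -/
theorem measure_ghostMass_ge_le (hk_meas : Measurable (Function.uncurry k))
    (hk : (Matrix.of k : Matrix 𝒳 𝒳 ℝ).PosSemidef) (n l : ℕ) {δ : ℝ} (hδ : 0 < δ) :
    Measure.pi (fun _ : Fin n => D) {S | ENNReal.ofReal (1 / δ) ≤ ghostMass k D l S} ≤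
      ENNReal.ofReal δ := by
  have hm : Measurable fun Z => ∫⁻ ω, ENNReal.ofReal (ghostWeight (correct k Z ω))
      ∂stdGaussian (EuclideanSpace ℝ (GhostIndex n l)) :=
    Measurable.lintegral_prod_right (measurable_ghostWeight_correct hk_meas hk)
  have hm2 : Measurable (ghostMass k D (n := n) l) :=
    Measurable.lintegral_prod_right (hm.comp measurable_withGhosts)
  have h1 := mul_meas_ge_le_lintegral (μ := Measure.pi (fun _ : Fin n => D)) hm2
    (ENNReal.ofReal (1 / δ))
  have h2 : ∫⁻ S, ghostMass k D (n := n) l S ∂Measure.pi (fun _ : Fin n => D) ≤ 1 :=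
    (lintegral_withGhosts hm).symm.trans_le (lintegral_ghostWeight_le_one D hk_meas hk n l)
  calc _ = ENNReal.ofReal δ * (ENNReal.ofReal (1 / δ) *
        Measure.pi (fun _ : Fin n => D) {S | ENNReal.ofReal (1 / δ) ≤ ghostMass k D l S}) := by
        rw [← mul_assoc, ← ENNReal.ofReal_mul hδ.le, mul_one_div_cancel hδ.ne', ENNReal.ofReal_one,
          one_mul]
    _ ≤ ENNReal.ofReal δ * 1 := by gcongr; exact h1.trans h2
    _ = _ := mul_one _

end Ghost

/-! ### Conditioning on a training sample and the PAC-Bayes change of measure -/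

section FixedSample

variable {𝒳 : Type*} {n : ℕ} {k : 𝒳 → 𝒳 → ℝ}

/-- Conditional standard deviation of the Gaussian process at `x` given its values at `X`. -/
noncomputable def noiseScale (k : 𝒳 → 𝒳 → ℝ) (X : Fin n → 𝒳) (x : 𝒳) : ℝ :=
  √(k x x - interpolator k X (gramVector k X x) x)

/-- Conditional value of the Gaussian process at `x` given its values `Υ` at `X`, driven by `ζ`. -/
noncomputable def testValue (k : 𝒳 → 𝒳 → ℝ) (X : Fin n → 𝒳) (x : 𝒳)
    (p : EuclideanSpace ℝ (Fin n) × ℝ) : ℝ :=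
  interpolator k X p.1 x + noiseScale k X x * p.2

open Classical in
/-- Indicator that the sign of `r` is the label `y`. -/
noncomputable def hit (r : ℝ) (y : Label) : ℝ := if Real.sign r = y then 1 else 0

theorem measurable_hit : Measurable fun p : ℝ × Label => hit p.1 p.2 :=
  Measurable.ite (measurableSet_eq_fun (measurable_sign.comp measurable_fst) (by fun_prop))
    measurable_const measurable_const

theorem interpolator_eq_dotProduct (hk : (Matrix.of k : Matrix 𝒳 𝒳 ℝ).PosSemidef)
    (X : Fin n → 𝒳) (Υ : Fin n → ℝ) (x : 𝒳) :
    interpolator k X Υ x = ((gramMatrix k X)⁻¹ *ᵥ gramVector k X x) ⬝ᵥ Υ := by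
  have h : ((gramMatrix k X)⁻¹)ᵀ = (gramMatrix k X)⁻¹ := by
    have h1 : (gramMatrix k X).IsHermitian := (gram_posSemidef hk X).isHermitian
    simpa [Matrix.IsHermitian, Matrix.conjTranspose_eq_transpose_of_trivial] using h1.inv
  rw [interpolator, Matrix.dotProduct_mulVec, ← Matrix.mulVec_transpose, h]

/-- Gaussian regression in sampling form: the value at a further point is the interpolated training
values plus independent noise, whatever other points are sampled alongside. -/
theorem lintegral_gpSample_eq_testValue (hk : (Matrix.of k : Matrix 𝒳 𝒳 ℝ).PosSemidef)
    {κ : Type*} [Fintype κ] [DecidableEq κ] (x : κ → 𝒳) (e : Fin n → κ) (p : κ)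
    (hu : IsUnit (gramMatrix k (x ∘ e))) {F : EuclideanSpace ℝ (Fin n) × ℝ → ℝ≥0∞}
    (hF : Measurable F) :
    ∫⁻ ω, F (WithLp.toLp 2 fun i => gpSample k x ω (e i), gpSample k x ω p)
        ∂stdGaussian (EuclideanSpace ℝ κ) =
      ∫⁻ q, F (q.1, testValue k (x ∘ e) (x p) q)
        ∂(gpPrior k (x ∘ e)).prod (gaussianReal 0 1) := by
  set a := (gramMatrix k (x ∘ e))⁻¹ *ᵥ gramVector k (x ∘ e) (x p)
  have hres := map_residual_multivariateGaussian (gram_posSemidef hk x) e p hu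
  have hvar : (gaussianReal 0 (gram k x p p - regressionVec (gram k x) e p ⬝ᵥ
      fun j => gram k x p (e j)).toNNReal) =
      (gaussianReal 0 1).map (noiseScale k (x ∘ e) (x p) * ·) := by
    rw [gaussianReal_map_const_mul]
    simp only [mul_zero, mul_one]
    congr 1
    rw [noiseScale, interpolator_eq_dotProduct hk]
    ext
    rw [NNReal.coe_mk]
    change ((k (x p) (x p) - a ⬝ᵥ gramVector k (x ∘ e) (x p)).toNNReal : ℝ) =
      √(k (x p) (x p) - a ⬝ᵥ gramVector k (x ∘ e) (x p)) ^ 2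
    -- Square root and `toNNReal` both truncate negative numbers to zero, so the sign of the
    -- conditional variance need not be determined.
    by_cases h : 0 ≤ k (x p) (x p) - a ⬝ᵥ gramVector k (x ∘ e) (x p)
    · rw [Real.sq_sqrt h, Real.coe_toNNReal _ h]
    · rw [Real.sqrt_eq_zero_of_nonpos (not_le.1 h).le, Real.toNNReal_of_nonpos (not_le.1 h).le]
      simp
  rw [hvar] at hres
  have hm : Measurable fun v : EuclideanSpace ℝ κ => ((WithLp.toLp 2 fun j => v (e j) :
        EuclideanSpace ℝ (Fin n)), v p - regressionVec (gram k x) e p ⬝ᵥ fun j => v (e j)) := by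
    simp only [dotProduct]
    fun_prop
  have hF2 : Measurable fun r : EuclideanSpace ℝ (Fin n) × ℝ => F (r.1, r.2 + a ⬝ᵥ r.1) := by
    simp only [dotProduct]
    fun_prop
  calc _ = ∫⁻ v, F (WithLp.toLp 2 fun i => v (e i), v p) ∂multivariateGaussian 0 (gram k x) := by
        rw [← map_gpSample, lintegral_map (by fun_prop) (measurable_gpSample_left _ _)]
    _ = ∫⁻ r, F (r.1, r.2 + a ⬝ᵥ r.1) ∂(multivariateGaussian 0 (gram k x)).map
          (fun v => ((WithLp.toLp 2 fun j => v (e j) :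
        EuclideanSpace ℝ (Fin n)), v p - regressionVec (gram k x) e p ⬝ᵥ fun j => v (e j))) := by
        rw [lintegral_map hF2 hm]
        refine lintegral_congr fun v => ?_
        congr 2
        change _ = v p - a ⬝ᵥ (fun j => v (e j)) + a ⬝ᵥ fun j => v (e j)
        ring
    _ = _ := by
        rw [hres, ← Measure.map_id (μ := multivariateGaussian 0 ((gram k x).submatrix e e)),
          Measure.map_prod_map _ _ measurable_id (by fun_prop), lintegral_map hF2 (by fun_prop)]
        refine lintegral_congr fun q => ?_
        simp only [Prod.map, id, testValue, interpolator_eq_dotProduct hk]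
        congr 2
        exact add_comm _ _

variable [MeasurableSpace 𝒳] (D : Measure (𝒳 × Label)) [IsProbabilityMeasure D]

/-- Probability that a prediction of the Gaussian process posterior with density `q` is correct. -/
noncomputable def hitProb (k : 𝒳 → 𝒳 → ℝ) (X : Fin n → 𝒳) (q : EuclideanSpace ℝ (Fin n) → ℝ)
    (z : 𝒳 × Label) : ℝ≥0∞ :=
  ∫⁻ p, ENNReal.ofReal (q p.1 * hit (testValue k X z.1 p) z.2)
    ∂(gpPrior k X).prod (gaussianReal 0 1)

instance isProbabilityMeasure_gpPrior (X : Fin n → 𝒳) : IsProbabilityMeasure (gpPrior k X) := by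
  unfold gpPrior
  infer_instance

theorem measurable_interpolator (hk_meas : Measurable (Function.uncurry k)) (X : Fin n → 𝒳) :
    Measurable fun p : (Fin n → ℝ) × 𝒳 => interpolator k X p.1 p.2 := by
  simp only [interpolator, dotProduct, Matrix.mulVec]
  refine Finset.measurable_sum _ fun i _ => Measurable.mul ?_ (by fun_prop)
  exact (hk_meas.comp (measurable_snd.prodMk measurable_const) :
    Measurable fun p : (Fin n → ℝ) × 𝒳 => Function.uncurry k (p.2, X i))

theorem measurable_testValue (hk_meas : Measurable (Function.uncurry k)) (X : Fin n → 𝒳) :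
    Measurable fun p : 𝒳 × (EuclideanSpace ℝ (Fin n) × ℝ) => testValue k X p.1 p.2 := by
  have h1 := measurable_interpolator hk_meas X
  have h2 : Measurable fun x => gramVector k X x :=
    measurable_pi_lambda _ fun i => (hk_meas.comp (measurable_id.prodMk measurable_const) :
      Measurable fun x => Function.uncurry k (x, X i))
  have h3 : Measurable fun x => k x x :=
    (hk_meas.comp (measurable_id.prodMk measurable_id) :
      Measurable fun x => Function.uncurry k (x, x))
  have h4 : Measurable (noiseScale k X) :=
    (h3.sub (h1.comp (h2.prodMk measurable_id))).sqrt
  have h5 : Measurable fun p : 𝒳 × (EuclideanSpace ℝ (Fin n) × ℝ) =>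
      ((p.2.1 : Fin n → ℝ), p.1) := by fun_prop
  exact (h1.comp h5).add ((h4.comp measurable_fst).mul (by fun_prop))

theorem measurable_hitProb (hk_meas : Measurable (Function.uncurry k)) (X : Fin n → 𝒳)
    {q : EuclideanSpace ℝ (Fin n) → ℝ} (hq : Measurable q) : Measurable (hitProb k X q) := by
  have h1 : Measurable fun r : (𝒳 × Label) × (EuclideanSpace ℝ (Fin n) × ℝ) =>
      testValue k X r.1.1 r.2 :=
    (measurable_testValue hk_meas X).comp (by fun_prop :
      Measurable fun r : (𝒳 × Label) × (EuclideanSpace ℝ (Fin n) × ℝ) => (r.1.1, r.2))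
  have h2 := measurable_hit.comp (h1.prodMk (measurable_snd.comp measurable_fst))
  have h3 : Measurable fun r : (𝒳 × Label) × (EuclideanSpace ℝ (Fin n) × ℝ) =>
      ENNReal.ofReal (q r.2.1 * hit (testValue k X r.1.1 r.2) r.1.2) :=
    ENNReal.measurable_ofReal.comp ((by fun_prop :
      Measurable fun r : (𝒳 × Label) × (EuclideanSpace ℝ (Fin n) × ℝ) => q r.2.1).mul h2)
  exact h3.lintegral_prod_right'

variable {D}

/-- Values at the training points of the process sampled on training and ghost points. -/
noncomputable def trainSample (k : 𝒳 → 𝒳 → ℝ) {l : ℕ} (S : Fin n → 𝒳 × Label)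
    (p : (Fin n × Fin l → 𝒳 × Label) × EuclideanSpace ℝ (GhostIndex n l)) :
    EuclideanSpace ℝ (Fin n) :=
  WithLp.toLp 2 fun i => gpSample k (fun p' => (withGhosts S p.1 p').1) p.2 (i, none)

theorem measurable_trainSample (hk_meas : Measurable (Function.uncurry k))
    (hk : (Matrix.of k : Matrix 𝒳 𝒳 ℝ).PosSemidef) {l : ℕ} (S : Fin n → 𝒳 × Label) :
    Measurable (trainSample k (l := l) S) := by
  have h0 : Measurable fun p : (Fin n × Fin l → 𝒳 × Label) × EuclideanSpace ℝ (GhostIndex n l) =>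
      ((fun p' => (withGhosts S p.1 p').1 : GhostIndex n l → 𝒳), p.2) := by
    have h := measurable_withGhosts (E := 𝒳 × Label) (n := n) (l := l)
    have h' : Measurable fun p : (Fin n × Fin l → 𝒳 × Label) ×
        EuclideanSpace ℝ (GhostIndex n l) => withGhosts S p.1 :=
      h.comp (measurable_const.prodMk measurable_fst)
    fun_prop
  have h1 := (measurable_gpSample (ι := GhostIndex n l) hk_meas hk).comp h0
  unfold trainSample
  exact (by fun_prop : Measurable fun v : EuclideanSpace ℝ (GhostIndex n l) =>
    (WithLp.toLp 2 fun i => v (i, none) : EuclideanSpace ℝ (Fin n))).comp h1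

/-- The marginal of the process at the training inputs does not depend on the ghosts, so posterior
densities defined on training values lift to the enlarged space with the same integrals. -/
theorem measurePreserving_trainSample (hk_meas : Measurable (Function.uncurry k))
    (hk : (Matrix.of k : Matrix 𝒳 𝒳 ℝ).PosSemidef) {l : ℕ} (S : Fin n → 𝒳 × Label) :
    MeasurePreserving (trainSample k (l := l) S)
      ((Measure.pi fun _ => D).prod (stdGaussian (EuclideanSpace ℝ (GhostIndex n l))))
      (gpPrior k (inputs S)) := by
  have hm := measurable_trainSample hk_meas hk (l := l) S
  refine ⟨hm, Measure.ext fun A hA => ?_⟩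
  rw [Measure.map_apply hm hA, Measure.prod_apply (hm hA)]
  have : ∀ T, stdGaussian (EuclideanSpace ℝ (GhostIndex n l))
      (Prod.mk T ⁻¹' (trainSample k (l := l) S ⁻¹' A)) = gpPrior k (inputs S) A := by
    intro T
    have h1 := map_comp_multivariateGaussian
      (gram_posSemidef hk fun p => (withGhosts S T p).1) fun i : Fin n => ((i, none) : GhostIndex n l)
    rw [← map_gpSample, Measure.map_map (by fun_prop) (measurable_gpSample_left _ _)] at h1
    have h2 := congrArg (fun μ => μ A) h1
    simp only at h2
    rw [Measure.map_apply (Measurable.comp (by fun_prop) (measurable_gpSample_left _ _)) hA] at h2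
    exact h2
  simp [this]

/-- A ghost point is a fresh draw from `D`, independent of the training sample, so its chance of
being predicted correctly under the posterior is the Gibbs accuracy. -/
theorem lintegral_mul_correct_ghost (hk_meas : Measurable (Function.uncurry k))
    (hk : (Matrix.of k : Matrix 𝒳 𝒳 ℝ).PosSemidef) {l : ℕ} (S : Fin n → 𝒳 × Label)
    (hu : IsUnit (gramMatrix k (inputs S))) {q : EuclideanSpace ℝ (Fin n) → ℝ} (hq : Measurable q)
    (i : Fin n) (j : Fin l) :
    ∫⁻ p, ENNReal.ofReal (q (trainSample k S p) * correct k (withGhosts S p.1) p.2 (i, some j))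
      ∂((Measure.pi fun _ => D).prod (stdGaussian (EuclideanSpace ℝ (GhostIndex n l)))) =
    ∫⁻ z, hitProb k (inputs S) q z ∂D := by
  have hc : Measurable fun p : (Fin n × Fin l → 𝒳 × Label) × EuclideanSpace ℝ (GhostIndex n l) =>
      correct k (withGhosts S p.1) p.2 (i, some j) := by
    have h := measurable_withGhosts (E := 𝒳 × Label) (n := n) (l := l)
    have h' : Measurable fun p : (Fin n × Fin l → 𝒳 × Label) ×
        EuclideanSpace ℝ (GhostIndex n l) => (withGhosts S p.1, p.2) :=
      (h.comp (measurable_const.prodMk measurable_fst)).prodMk measurable_snd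
    exact (measurable_pi_apply (i, some j)).comp (g := fun v : GhostIndex n l → ℝ => v (i, some j))
      ((measurable_correct (ι := GhostIndex n l) hk_meas hk).comp h')
  rw [lintegral_prod (fun p => ENNReal.ofReal (q (trainSample k S p) *
    correct k (withGhosts S p.1) p.2 (i, some j))) (((hq.comp (measurable_trainSample hk_meas hk S)).mul
    hc).ennreal_ofReal).aemeasurable]
  have h1 : ∀ T : Fin n × Fin l → 𝒳 × Label, ∫⁻ ω, ENNReal.ofReal (q (trainSample k S (T, ω)) *
      correct k (withGhosts S T) ω (i, some j)) ∂stdGaussian (EuclideanSpace ℝ (GhostIndex n l)) =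
      hitProb k (inputs S) q (T (i, j)) := by
    intro T
    exact lintegral_gpSample_eq_testValue hk (fun p => (withGhosts S T p).1)
      (fun i : Fin n => ((i, none) : GhostIndex n l)) (i, some j) hu
      (F := fun r => ENNReal.ofReal (q r.1 * hit r.2 (T (i, j)).2))
      (((hq.comp measurable_fst).mul (measurable_hit.comp
        (measurable_snd.prodMk measurable_const))).ennreal_ofReal)
  simp only [h1]
  exact (measurePreserving_eval (fun _ : Fin n × Fin l => D) (i, j)).lintegral_comp
    (measurable_hitProb hk_meas _ hq)

/-- The change of measure before integration. Two tangent-line bounds on the logarithm replace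
Jensen's inequality and the variational formula for divergence, leaving an inequality linear in the
weight and in the group sums. -/
theorem pacBayes_pointwise {l : ℕ} {u : GhostIndex n l → ℝ} (hu : ∀ p, 0 ≤ u p) {Q c d : ℝ}
    (hQ : 0 ≤ Q) (hc : 0 < c) (hd : 0 < d) (hsupp : Q ≠ 0 → ∀ i, u (i, none) = 1) :
    ∑ i : Fin n, (Q * (1 - Real.log d) - Q * (∑ o, u (i, o)) / (((l : ℝ) + 1) * d)) -
      Q * Real.log Q ≤ ghostWeight u / c - Q + Q * Real.log c := by
  rcases hQ.eq_or_lt with rfl | hQ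
  · simpa using div_nonneg (ghostWeight_nonneg hu) hc.le
  have h1 := hsupp hQ.ne'
  have hl : (0 : ℝ) < l + 1 := by positivity
  have ht : ∀ i, 0 < ∑ o, u (i, o) := fun i =>
    lt_of_lt_of_le one_pos ((h1 i).symm.le.trans
      (Finset.single_le_sum (f := fun o => u (i, o)) (fun o _ => hu _) (Finset.mem_univ none)))
  have hW : ghostWeight u = ∏ i, ((l : ℝ) + 1) / ∑ o, u (i, o) := by
    simp [ghostWeight, groupWeight, h1]
  have hW0 : 0 < ghostWeight u := by
    rw [hW]; exact Finset.prod_pos fun i _ => div_pos hl (ht i)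
  have hlogW : Real.log (ghostWeight u) = ∑ i, Real.log (((l : ℝ) + 1) / ∑ o, u (i, o)) := by
    rw [hW, Real.log_prod]
    exact fun i _ => (div_pos hl (ht i)).ne'
  have hi : ∀ i, 1 - Real.log d - (∑ o, u (i, o)) / (((l : ℝ) + 1) * d) ≤
      Real.log (((l : ℝ) + 1) / ∑ o, u (i, o)) := by
    intro i
    -- The tangent is taken where the fraction of correct points in the group equals d.
    have h := Real.log_le_sub_one_of_pos (div_pos (ht i) (mul_pos hl hd))
    rw [Real.log_div (ht i).ne' (mul_pos hl hd).ne', Real.log_mul hl.ne' hd.ne'] at h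
    rw [Real.log_div hl.ne' (ht i).ne']
    linarith
  have hsum := Finset.sum_le_sum fun i (_ : i ∈ Finset.univ) => hi i
  rw [← hlogW] at hsum
  -- Fenchel-Young: the weight is compared with Q c, which produces the entropy term Q log Q and the
  -- term Q log c.
  have h2 := Real.log_le_sub_one_of_pos (div_pos hW0 (mul_pos hQ hc))
  rw [Real.log_div hW0.ne' (mul_pos hQ hc).ne', Real.log_mul hQ.ne' hc.ne'] at h2
  have h3 := mul_le_mul_of_nonneg_left (hsum.trans (by linarith :
    Real.log (ghostWeight u) ≤ ghostWeight u / (Q * c) - 1 + Real.log Q + Real.log c)) hQ.le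
  rw [Finset.mul_sum] at h3
  have h4 : Q * (ghostWeight u / (Q * c) - 1 + Real.log Q + Real.log c) =
      ghostWeight u / c - Q + Q * Real.log Q + Q * Real.log c := by
    field_simp
  rw [h4] at h3
  have h5 : ∀ i : Fin n, Q * (1 - Real.log d) - Q * (∑ o, u (i, o)) / (((l : ℝ) + 1) * d) =
      Q * (1 - Real.log d - (∑ o, u (i, o)) / (((l : ℝ) + 1) * d)) := fun i => by ring
  simp only [h5]
  linarith

/-- The PAC-Bayes inequality for consistent predictors with correctness indicators `u`, prior `μ`
and posterior density `Q`. -/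
theorem pacBayes_integral {Ω : Type*} [MeasurableSpace Ω] {μ : Measure Ω} {l : ℕ}
    {u : Ω → GhostIndex n l → ℝ} {Q : Ω → ℝ} (hum : Measurable u) (hu0 : ∀ p o, 0 ≤ u p o)
    (hu1 : ∀ p o, u p o ≤ 1) (hQm : Measurable Q) (hQ0 : ∀ p, 0 ≤ Q p) (hQi : Integrable Q μ)
    (hQint : ∫ p, Q p ∂μ = 1) (hQl : Integrable (fun p => Q p * Real.log (Q p)) μ)
    (hQs : ∀ p, Q p ≠ 0 → ∀ i, u p (i, none) = 1) {g : ℝ} (hg0 : 0 ≤ g)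
    (hQu_some : ∀ i j, ∫ p, Q p * u p (i, some j) ∂μ = g) {c : ℝ} (hc : 0 < c)
    (hWl : ∫⁻ p, ENNReal.ofReal (ghostWeight (u p)) ∂μ ≤ ENNReal.ofReal c) :
    -n * Real.log ((1 + l * g) / (l + 1)) ≤ ∫ p, Q p * Real.log (Q p) ∂μ + Real.log c := by
  have hup : ∀ o, Measurable fun p => u p o := fun o => (measurable_pi_apply o).comp hum
  have hQui : ∀ o, Integrable (fun p => Q p * u p o) μ := fun o =>
    hQi.mono (hQm.mul (hup o)).aestronglyMeasurable (ae_of_all _ fun p => by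
      rw [Real.norm_of_nonneg (mul_nonneg (hQ0 p) (hu0 p o)), Real.norm_of_nonneg (hQ0 p)]
      exact mul_le_of_le_one_right (hQ0 p) (hu1 p o))
  have hQu_none : ∀ i, ∫ p, Q p * u p (i, none) ∂μ = 1 := by
    intro i
    rw [← hQint]
    refine integral_congr_ae (ae_of_all _ fun p => ?_)
    by_cases h : Q p = 0
    · simp [h]
    · simp [hQs p h i]
  have hQt : ∀ i, ∫ p, Q p * ∑ o, u p (i, o) ∂μ = 1 + l * g := by
    intro i
    simp_rw [Finset.mul_sum]
    rw [integral_finsetSum _ fun o _ => hQui _, Fintype.sum_option, hQu_none]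
    simp [hQu_some]
  have hQti : ∀ i, Integrable (fun p => Q p * ∑ o, u p (i, o)) μ := by
    intro i
    simp_rw [Finset.mul_sum]
    exact integrable_finsetSum _ fun o _ => hQui _
  have hW0 : ∀ p, 0 ≤ ghostWeight (u p) := fun p => ghostWeight_nonneg (hu0 p)
  have hWi : Integrable (fun p => ghostWeight (u p)) μ := by
    refine ⟨(measurable_ghostWeight.comp hum).aestronglyMeasurable, ?_⟩
    rw [hasFiniteIntegral_iff_ofReal (ae_of_all _ hW0)]
    exact hWl.trans_lt ENNReal.ofReal_lt_top
  have hWint : ∫ p, ghostWeight (u p) ∂μ ≤ c := by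
    rw [integral_eq_lintegral_of_nonneg_ae (ae_of_all _ hW0)
      (measurable_ghostWeight.comp hum).aestronglyMeasurable]
    exact ENNReal.toReal_le_of_le_ofReal hc.le hWl
  have hl : (0 : ℝ) < l + 1 := by positivity
  set d := (1 + l * g) / ((l : ℝ) + 1)
  have hd : 0 < d := by positivity
  have hi : ∀ i : Fin n, Integrable (fun p => Q p * (1 - Real.log d) -
      Q p * (∑ o, u p (i, o)) / (((l : ℝ) + 1) * d)) μ :=
    fun i => (hQi.mul_const _).sub ((hQti i).div_const _)
  have hmono := integral_mono (μ := μ)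
    (f := fun p => ∑ i : Fin n, (Q p * (1 - Real.log d) -
      Q p * (∑ o, u p (i, o)) / (((l : ℝ) + 1) * d)) - Q p * Real.log (Q p))
    (g := fun p => ghostWeight (u p) / c - Q p + Q p * Real.log c)
    ((integrable_finsetSum _ fun i _ => hi i).sub hQl)
    (((hWi.div_const _).sub hQi).add (hQi.mul_const _))
    (fun p => pacBayes_pointwise (hu0 p) (hQ0 p) hc hd (hQs p))
  have hR : ∫ p, (ghostWeight (u p) / c - Q p + Q p * Real.log c) ∂μ =
      (∫ p, ghostWeight (u p) ∂μ) / c - 1 + Real.log c := by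
    have hi' : Integrable (fun p => ghostWeight (u p) / c - Q p) μ := (hWi.div_const _).sub hQi
    rw [integral_add hi' (hQi.mul_const _), integral_sub (hWi.div_const _) hQi,
      integral_mul_const, integral_div, hQint, one_mul]
  rw [integral_sub (integrable_finsetSum _ fun i _ => hi i) hQl,
    integral_finsetSum _ fun i _ => hi i, hR] at hmono
  -- Here d is the posterior mean of the fraction of correct points in a group, training point
  -- included, so the linear terms cancel on average and leave -log d.
  have hterm : ∀ i : Fin n, ∫ p, (Q p * (1 - Real.log d) -
      Q p * (∑ o, u p (i, o)) / (((l : ℝ) + 1) * d)) ∂μ = -Real.log d := by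
    intro i
    rw [integral_sub (hQi.mul_const _) ((hQti i).div_const _), integral_mul_const, integral_div,
      hQint, hQt]
    have : (1 + l * g) / (((l : ℝ) + 1) * d) = 1 := by
      rw [← div_div]
      exact div_self hd.ne'
    rw [this]; ring
  simp only [hterm, Finset.sum_const, Finset.card_univ, Fintype.card_fin, nsmul_eq_mul] at hmono
  have : (∫ p, ghostWeight (u p) ∂μ) / c ≤ 1 := (div_le_one hc).2 hWint
  linarith

/-- The PAC-Bayes inequality for consistent posteriors, at a fixed training sample. -/
theorem pacBayes_of_ghostMass_le (hk_meas : Measurable (Function.uncurry k))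
    (hk : (Matrix.of k : Matrix 𝒳 𝒳 ℝ).PosSemidef) {l : ℕ} (S : Fin n → 𝒳 × Label)
    (hu : IsUnit (gramMatrix k (inputs S))) {q : EuclideanSpace ℝ (Fin n) → ℝ} (hq : Measurable q)
    (hq0 : ∀ Υ, 0 ≤ q Υ) (hqi : Integrable q (gpPrior k (inputs S)))
    (hq1 : ∫ Υ, q Υ ∂gpPrior k (inputs S) = 1)
    (hsupp : ∀ Υ, q Υ ≠ 0 → Υ ∈ orthant (labels S))
    (hent : Integrable (fun Υ => q Υ * Real.log (q Υ)) (gpPrior k (inputs S)))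
    {c : ℝ} (hc : 0 < c) (hmass : ghostMass k D l S ≤ ENNReal.ofReal c)
    {g : ℝ} (hg0 : 0 ≤ g) (hg : ∫⁻ z, hitProb k (inputs S) q z ∂D = ENNReal.ofReal g) :
    -n * Real.log ((1 + l * g) / (l + 1)) ≤
      ∫ Υ, q Υ * Real.log (q Υ) ∂gpPrior k (inputs S) + Real.log c := by
  have hmp := measurePreserving_trainSample (D := D) hk_meas hk (l := l) S
  have hgm : Measurable fun p : (Fin n × Fin l → 𝒳 × Label) ×
      EuclideanSpace ℝ (GhostIndex n l) => (withGhosts S p.1, p.2) :=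
    ((measurable_withGhosts (E := 𝒳 × Label)).comp
      (measurable_const.prodMk measurable_fst)).prodMk measurable_snd
  have hum := (measurable_correct (ι := GhostIndex n l) hk_meas hk).comp hgm
  have hup : ∀ o, Measurable fun p : (Fin n × Fin l → 𝒳 × Label) ×
      EuclideanSpace ℝ (GhostIndex n l) => correct k (withGhosts S p.1) p.2 o :=
    fun o => (measurable_pi_apply o).comp (g := fun v : GhostIndex n l → ℝ => v o) hum
  have hQm : Measurable fun p => q (trainSample k (l := l) S p) := hq.comp hmp.measurable
  have hQint := integral_map (μ := (Measure.pi fun _ : Fin n × Fin l => D).prod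
    (stdGaussian (EuclideanSpace ℝ (GhostIndex n l)))) hmp.measurable.aemeasurable
    hq.aestronglyMeasurable
  have hQlint := integral_map (μ := (Measure.pi fun _ : Fin n × Fin l => D).prod
    (stdGaussian (EuclideanSpace ℝ (GhostIndex n l)))) hmp.measurable.aemeasurable
    (hq.mul (Real.measurable_log.comp hq)).aestronglyMeasurable
  rw [hmp.map_eq] at hQint hQlint
  have hQu : ∀ i j, ∫ p, q (trainSample k (l := l) S p) *
      correct k (withGhosts S p.1) p.2 (i, some j) ∂((Measure.pi fun _ : Fin n × Fin l => D).prod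
      (stdGaussian (EuclideanSpace ℝ (GhostIndex n l)))) = g := by
    intro i j
    rw [integral_eq_lintegral_of_nonneg_ae
      (ae_of_all _ fun p => mul_nonneg (hq0 _) (correct_nonneg _ _ _ _))
      (hQm.mul (hup _)).aestronglyMeasurable, lintegral_mul_correct_ghost hk_meas hk S hu hq i j,
      hg, ENNReal.toReal_ofReal hg0]
  have hWl : ∫⁻ p, ENNReal.ofReal (ghostWeight (correct k (withGhosts S p.1) p.2))
      ∂((Measure.pi fun _ : Fin n × Fin l => D).prod
      (stdGaussian (EuclideanSpace ℝ (GhostIndex n l)))) ≤ ENNReal.ofReal c :=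
    le_trans (le_of_eq (lintegral_prod _
      ((measurable_ghostWeight.comp hum).ennreal_ofReal).aemeasurable)) hmass
  have h := pacBayes_integral hum (fun p o => correct_nonneg _ _ _ _)
    (fun p o => correct_le_one _ _ _ _) hQm (fun p => hq0 _)
    (hmp.integrable_comp_of_integrable hqi) (hQint.symm.trans hq1)
    (hmp.integrable_comp_of_integrable hent) (fun p hp i => if_pos (hsupp _ hp i)) hg0 hQu hc hWl
  exact h.trans_eq (congrArg (· + Real.log c) hQlint.symm)

end FixedSample

/-- Argument by contradiction: if the bound fails, the Gibbs accuracy 1 - G is below w = exp(-c),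
and the PAC-Bayes inequality with n ghosts per point gives nc - 1 ≤ (n - 1)c - log(2n). As c ≥ 0,
this contradicts log(2n) > 1. -/
theorem le_riskBound_of_pacBayes {n : ℕ} (hn : 2 ≤ n) {δ κ r G : ℝ} (hδ : 0 < δ) (hκ : 0 ≤ κ)
    (hδ1 : δ < 1) (hr : r ≤ 1) (hG : G ≤ 1) (hrG : r ≤ Real.exp 1 * G)
    (h : -n * Real.log ((1 + n * (1 - G)) / (n + 1)) ≤ κ + Real.log (1 / δ)) :
    r ≤ riskBound n δ κ := by
  by_contra hcon
  rw [not_le, riskBound] at hcon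
  have hn' : (2 : ℝ) ≤ n := by exact_mod_cast hn
  have hn1 : (0 : ℝ) < n - 1 := by linarith
  set c := (κ + Real.log (2 * n / δ)) / ((n : ℝ) - 1) with hc
  set w := Real.exp (-c) with hw
  have hw0 : 0 < w := Real.exp_pos _
  have hlogw : Real.log w = -c := Real.log_exp _
  have he : 2 < Real.exp 1 := by
    have := Real.exp_one_gt_d9; linarith
  -- A violated bound lies below r ≤ 1, so e(1 - w) < 1 with e > 2.
  have hw2 : 1 / 2 < w := by nlinarith
  have hc0 : 0 ≤ c := by
    refine div_nonneg (add_nonneg hκ (Real.log_nonneg ?_)) hn1.le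
    rw [le_div_iff₀ hδ]; linarith
  have hw1 : w ≤ 1 := Real.exp_le_one_iff.2 (by linarith)
  have hGw : 1 - G < w := by
    have : Real.exp 1 * (1 - w) < Real.exp 1 * G := hcon.trans_le hrG
    have := lt_of_mul_lt_mul_left this (Real.exp_pos 1).le
    linarith
  have hd0 : 0 < (1 + n * (1 - G)) / ((n : ℝ) + 1) := by
    have : 0 ≤ 1 - G := by linarith
    positivity
  -- The 1 contributed by the training point is at most 2w, so 1 + nw ≤ (n + 2)w; this is where w >
  -- 1/2 is needed.
  have hd : (1 + n * (1 - G)) / ((n : ℝ) + 1) ≤ w * (1 + 1 / (n + 1)) := by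
    rw [div_le_iff₀ (by positivity)]
    have : w * (1 + 1 / ((n : ℝ) + 1)) * (n + 1) = w * (n + 2) := by field_simp; ring
    rw [this]
    nlinarith
  have h1 := Real.log_le_log hd0 hd
  rw [Real.log_mul hw0.ne' (by positivity), hlogw] at h1
  have h2 : Real.log (1 + 1 / ((n : ℝ) + 1)) ≤ 1 / (n + 1) := by
    have := Real.log_le_sub_one_of_pos (by positivity : (0 : ℝ) < 1 + 1 / ((n : ℝ) + 1))
    linarith
  have h3 : (n : ℝ) * (1 / (n + 1)) ≤ 1 := by
    rw [mul_one_div, div_le_one (by positivity)]; linarith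
  have h4 : (n : ℝ) * Real.log ((1 + n * (1 - G)) / (n + 1)) ≤ -(n * c) + 1 := by
    have := mul_le_mul_of_nonneg_left (h1.trans (add_le_add_right h2 (-c))) (by linarith : (0 : ℝ) ≤ n)
    linarith
  have h5 : κ + Real.log (1 / δ) = (n - 1) * c - Real.log (2 * n) := by
    rw [hc, mul_div_cancel₀ _ hn1.ne', Real.log_div (x := 2 * (n : ℝ)) (by positivity) hδ.ne',
      one_div, Real.log_inv]
    ring
  have h6 : (1 : ℝ) < Real.log (2 * n) := by
    rw [Real.lt_log_iff_exp_lt (by positivity)]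
    have := Real.exp_one_lt_d9
    linarith
  linarith

theorem sign_eq_label_iff (r : ℝ) (y : Label) : Real.sign r = y ↔ 0 < (y : ℝ) * r := by
  obtain ⟨y, rfl | rfl⟩ := y
  · rcases lt_trichotomy r 0 with h | rfl | h
    · simp [Real.sign_of_neg h, h.not_gt]; norm_num
    · simp
    · simp [Real.sign_of_pos h, h]
  · rcases lt_trichotomy r 0 with h | rfl | h
    · simp [Real.sign_of_neg h, h]
    · simp
    · simp [Real.sign_of_pos h, h.not_gt]; norm_num

/-! ### From Gibbs risk to the risk of the centre of mass -/

section Posterior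

variable {𝒳 : Type*} {n : ℕ} {k : 𝒳 → 𝒳 → ℝ}

theorem orthant_labels (S : Fin n → 𝒳 × Label) :
    orthant (labels S) = {Υ | ∀ i, 0 < labels S i * Υ i} := by
  ext Υ
  exact forall_congr' fun i => sign_eq_label_iff _ _

theorem measurableSet_orthant_labels (S : Fin n → 𝒳 × Label) :
    MeasurableSet (orthant (labels S)) := by
  have : orthant (labels S) = ⋂ i, {Υ | 0 < labels S i * Υ i} := by
    rw [orthant_labels]; ext; simp
  rw [this]
  exact MeasurableSet.iInter fun i => measurableSet_lt measurable_const (by fun_prop)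

theorem convex_orthant_labels (S : Fin n → 𝒳 × Label) : Convex ℝ (orthant (labels S)) := by
  rw [orthant_labels]
  intro v hv w hw a b ha hb hab i
  have h1 := hv i
  have h2 := hw i
  have : labels S i * (a • v + b • w) i = a * (labels S i * v i) + b * (labels S i * w i) := by
    simp only [PiLp.add_apply, PiLp.smul_apply, smul_eq_mul]; ring
  rw [this]
  rcases ha.eq_or_lt with rfl | ha
  · obtain rfl : b = 1 := by linarith
    simpa using h2
  · exact add_pos_of_pos_of_nonneg (mul_pos ha h1) (mul_nonneg hb h2.le)

/-- The interpolated value at `x` as a linear functional of the labels. -/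
noncomputable def interpolatorLin (k : 𝒳 → 𝒳 → ℝ) (X : Fin n → 𝒳) (x : 𝒳) :
    EuclideanSpace ℝ (Fin n) →ₗ[ℝ] ℝ where
  toFun Υ := interpolator k X Υ x
  map_add' Υ Υ' := by simp [interpolator, Matrix.mulVec_add]
  map_smul' c Υ := by simp [interpolator, Matrix.mulVec_smul]

variable [MeasurableSpace 𝒳] {D : Measure (𝒳 × Label)} [IsProbabilityMeasure D]

/-- This replaces the density by a representation of the posterior as a linear image of ν, the form
in which Grünbaum's inequality can be used. -/
theorem hitProb_eq_of_withDensity (hk_meas : Measurable (Function.uncurry k)) (X : Fin n → 𝒳)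
    {q : EuclideanSpace ℝ (Fin n) → ℝ} (hq : Measurable q) (hq0 : ∀ Υ, 0 ≤ q Υ)
    {ν : Measure (Fin n → ℝ)} [IsProbabilityMeasure ν]
    {B : (Fin n → ℝ) →ₗ[ℝ] EuclideanSpace ℝ (Fin n)}
    (hB : (gpPrior k X).withDensity (fun Υ => ENNReal.ofReal (q Υ)) = ν.map B) (z : 𝒳 × Label) :
    hitProb k X q z = (ν.prod (gaussianReal 0 1))
      {p | Real.sign (interpolator k X (B p.1) z.1 + noiseScale k X z.1 * p.2) = z.2} := by
  have hBm : Measurable B := B.continuous_of_finiteDimensional.measurable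
  have ht : Measurable fun p : EuclideanSpace ℝ (Fin n) × ℝ => testValue k X z.1 p :=
    (measurable_testValue hk_meas X).comp (measurable_const.prodMk measurable_id)
  have hA : MeasurableSet {p : EuclideanSpace ℝ (Fin n) × ℝ |
      Real.sign (testValue k X z.1 p) = z.2} :=
    measurableSet_eq_fun (measurable_sign.comp ht) measurable_const
  have h1 : ∀ p : EuclideanSpace ℝ (Fin n) × ℝ,
      ENNReal.ofReal (q p.1 * hit (testValue k X z.1 p) z.2) = ENNReal.ofReal (q p.1) *
        {p | Real.sign (testValue k X z.1 p) = z.2}.indicator 1 p := by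
    intro p
    rw [ENNReal.ofReal_mul (hq0 _)]
    by_cases h : Real.sign (testValue k X z.1 p) = z.2 <;> simp [hit, h]
  have hqm : Measurable fun p : EuclideanSpace ℝ (Fin n) × ℝ => ENNReal.ofReal (q p.1) := by
    fun_prop
  unfold hitProb
  simp only [h1]
  refine (lintegral_withDensity_eq_lintegral_mul _ hqm (measurable_one.indicator hA)).symm.trans ?_
  rw [lintegral_indicator_one hA, ← prod_withDensity_left hq.ennreal_ofReal, hB,
    ← Measure.map_id (μ := gaussianReal 0 1), Measure.map_prod_map _ _ hBm measurable_id,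
    Measure.map_apply (hBm.prodMap measurable_id) hA, Measure.map_id]
  rfl

/-- A posterior for which the interpolator of its centre of mass errs at a point errs there itself
with probability at least `1/e`. -/
theorem hitProb_add_exp_neg_one_le (hk_meas : Measurable (Function.uncurry k)) (X : Fin n → 𝒳)
    {q : EuclideanSpace ℝ (Fin n) → ℝ} (hq : Measurable q) (hq0 : ∀ Υ, 0 ≤ q Υ)
    {C : Set (Fin n → ℝ)} (hC : Convex ℝ C) (hCm : MeasurableSet C)
    (hC0 : Measure.pi (fun _ : Fin n => gaussianReal 0 1) C ≠ 0)
    {B : (Fin n → ℝ) →ₗ[ℝ] EuclideanSpace ℝ (Fin n)}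
    (hB : (gpPrior k X).withDensity (fun Υ => ENNReal.ofReal (q Υ)) =
      ((Measure.pi fun _ : Fin n => gaussianReal 0 1)[|C]).map B)
    {v : Fin n → ℝ} {c : ℝ} (hc : 0 ≤ c)
    (hv : ∀ L : EuclideanSpace ℝ (Fin n) →ₗ[ℝ] ℝ,
      ∫ ξ in C, L (B ξ) ∂Measure.pi (fun _ : Fin n => gaussianReal 0 1) = c * L (WithLp.toLp 2 v))
    (z : 𝒳 × Label) (hz : Real.sign (interpolator k X v z.1) ≠ (z.2 : ℝ)) :
    hitProb k X q z + ENNReal.ofReal (Real.exp (-1)) ≤ 1 := by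
  set γ := Measure.pi fun _ : Fin n => gaussianReal 0 1
  have : IsProbabilityMeasure γ[|C] := cond_isProbabilityMeasure hC0
  have hBm : Measurable B := B.continuous_of_finiteDimensional.measurable
  set y : ℝ := z.2.1
  set s := noiseScale k X z.1
  set L : (Fin n → ℝ) →ₗ[ℝ] ℝ := y • (interpolatorLin k X z.1 ∘ₗ B)
  have hLm : Measurable L := L.continuous_of_finiteDimensional.measurable
  have hL : ∀ ξ, L ξ = y * interpolator k X (B ξ) z.1 := fun ξ => rfl
  -- Only the sign matters: the posterior mean need be no more than a nonnegative multiple of v, and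
  -- an error, including the value 0, means that label times interpolated value is nonpositive.
  have hmean : ∫ ξ in C, L ξ ∂γ ≤ 0 := by
    have h1 : ∫ ξ in C, L ξ ∂γ = y * (c * interpolator k X v z.1) := by
      have := hv (interpolatorLin k X z.1)
      change ∫ ξ in C, y * interpolatorLin k X z.1 (B ξ) ∂γ = _
      rw [integral_const_mul, this]
      rfl
    rw [h1, mul_left_comm]
    rw [ne_eq, sign_eq_label_iff, not_lt] at hz
    exact mul_nonpos_of_nonneg_of_nonpos hc hz
  have hG := exp_neg_one_mul_le_of_setIntegral_nonpos hC hCm L (y * s) hC0 hmean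
  set bad : Set ((Fin n → ℝ) × ℝ) := {p | L p.1 + y * s * p.2 ≤ 0}
  have hbad : MeasurableSet bad :=
    measurableSet_le (f := fun p : (Fin n → ℝ) × ℝ => L p.1 + y * s * p.2) (g := fun _ => 0)
      (by fun_prop) (by fun_prop)
  have hcond : ENNReal.ofReal (Real.exp (-1)) ≤ (γ[|C].prod (gaussianReal 0 1)) bad := by
    have h1 : (γ.restrict C).prod (gaussianReal 0 1) =
        (γ.prod (gaussianReal 0 1)).restrict (C ×ˢ Set.univ) := by
      rw [← Measure.prod_restrict, Measure.restrict_univ]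
    have h2 : (γ[|C].prod (gaussianReal 0 1)) bad = (γ C)⁻¹ * (γ.prod (gaussianReal 0 1))
        {p | p.1 ∈ C ∧ L p.1 + y * s * p.2 ≤ 0} := by
      rw [ProbabilityTheory.cond, Measure.prod_smul_left, Measure.smul_apply, smul_eq_mul, h1,
        Measure.restrict_apply hbad]
      congr 2
      ext p
      simp [bad, and_comm]
    rw [h2]
    calc ENNReal.ofReal (Real.exp (-1)) = (γ C)⁻¹ * (ENNReal.ofReal (Real.exp (-1)) * γ C) := by
          rw [mul_left_comm, ENNReal.inv_mul_cancel hC0 (measure_ne_top _ _), mul_one]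
      _ ≤ _ := by gcongr
  rw [hitProb_eq_of_withDensity hk_meas X hq hq0 hB z]
  have hdisj : Disjoint
      {p : (Fin n → ℝ) × ℝ | Real.sign (interpolator k X (B p.1) z.1 + s * p.2) = z.2} bad := by
    rw [Set.disjoint_left]
    intro p hp hp'
    have h1 := (sign_eq_label_iff _ _).1 hp
    have h2 : L p.1 + y * s * p.2 ≤ 0 := hp'
    rw [hL] at h2
    have : y * (interpolator k X (B p.1) z.1 + s * p.2) =
      y * interpolator k X (B p.1) z.1 + y * s * p.2 := by ring
    linarith
  calc _ ≤ (γ[|C].prod (gaussianReal 0 1))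
        {p | Real.sign (interpolator k X (B p.1) z.1 + s * p.2) = z.2} +
        (γ[|C].prod (gaussianReal 0 1)) bad := by gcongr
    _ = (γ[|C].prod (gaussianReal 0 1)) (_ ∪ bad) := (measure_union hdisj hbad).symm
    _ ≤ 1 := prob_le_one

/-- The risk bound for a log-concave consistent posterior, off the event of large ghost mass. -/
theorem risk_le_riskBound_of_ghostMass (hk_meas : Measurable (Function.uncurry k))
    (hk : (Matrix.of k : Matrix 𝒳 𝒳 ℝ).PosSemidef) (hn : 2 ≤ n) {δ : ℝ}
    (hδ : δ ∈ Set.Ioo (0 : ℝ) 1) (S : Fin n → 𝒳 × Label)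
    (hu : IsUnit (gramMatrix k (inputs S)))
    (hmass : ghostMass k D n S ≤ ENNReal.ofReal (1 / δ))
    {q : EuclideanSpace ℝ (Fin n) → ℝ} (hq : Measurable q) (hq0 : ∀ Υ, 0 ≤ q Υ)
    (hsupp : ∀ Υ, q Υ ≠ 0 → Υ ∈ orthant (labels S))
    {C : Set (Fin n → ℝ)} (hC : Convex ℝ C) (hCm : MeasurableSet C)
    (hC0 : Measure.pi (fun _ : Fin n => gaussianReal 0 1) C ≠ 0)
    {B : (Fin n → ℝ) →ₗ[ℝ] EuclideanSpace ℝ (Fin n)}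
    (hB : (gpPrior k (inputs S)).withDensity (fun Υ => ENNReal.ofReal (q Υ)) =
      ((Measure.pi fun _ : Fin n => gaussianReal 0 1)[|C]).map B)
    (hent : Integrable (fun ξ => Real.log (q (B ξ)))
      (Measure.pi fun _ : Fin n => gaussianReal 0 1)[|C])
    {v : Fin n → ℝ} {c : ℝ} (hc : 0 ≤ c)
    (hv : ∀ L : EuclideanSpace ℝ (Fin n) →ₗ[ℝ] ℝ,
      ∫ ξ in C, L (B ξ) ∂Measure.pi (fun _ : Fin n => gaussianReal 0 1) =
        c * L (WithLp.toLp 2 v)) :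
    risk D (interpolator k (inputs S) v) ≤ riskBound n δ
      (∫ ξ, Real.log (q (B ξ)) ∂(Measure.pi fun _ : Fin n => gaussianReal 0 1)[|C]) := by
  set γ := Measure.pi fun _ : Fin n => gaussianReal 0 1
  set P := gpPrior k (inputs S)
  have : IsProbabilityMeasure γ[|C] := cond_isProbabilityMeasure hC0
  have hBm : Measurable B := B.continuous_of_finiteDimensional.measurable
  have hqq : ∀ Υ, (ENNReal.ofReal (q Υ)).toReal = q Υ := fun Υ => ENNReal.toReal_ofReal (hq0 Υ)
  have hlogm : Measurable fun Υ => Real.log (q Υ) := Real.measurable_log.comp hq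
  have hone : ∫⁻ Υ, ENNReal.ofReal (q Υ) ∂P = 1 := by
    have h := congrArg (fun μ => μ Set.univ) hB
    simp only [withDensity_apply _ MeasurableSet.univ, Measure.restrict_univ] at h
    rw [h, Measure.map_apply hBm MeasurableSet.univ]
    simp
  have hqi : Integrable q P := ⟨hq.aestronglyMeasurable, by
    rw [hasFiniteIntegral_iff_ofReal (ae_of_all _ hq0), hone]; exact ENNReal.one_lt_top⟩
  have hq1 : ∫ Υ, q Υ ∂P = 1 := by
    rw [integral_eq_lintegral_of_nonneg_ae (ae_of_all _ hq0) hq.aestronglyMeasurable, hone]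
    simp
  have hentP : Integrable (fun Υ => q Υ * Real.log (q Υ)) P := by
    have h := (integrable_map_measure hlogm.aestronglyMeasurable hBm.aemeasurable).2 hent
    rw [← hB, integrable_withDensity_iff hq.ennreal_ofReal
      (ae_of_all _ fun _ => ENNReal.ofReal_lt_top)] at h
    refine h.congr (ae_of_all _ fun Υ => ?_)
    simp only [hqq]; ring
  have hentI : ∫ Υ, q Υ * Real.log (q Υ) ∂P = ∫ ξ, Real.log (q (B ξ)) ∂γ[|C] := by
    rw [← integral_map hBm.aemeasurable (f := fun Υ => Real.log (q Υ)) hlogm.aestronglyMeasurable,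
      ← hB, integral_withDensity_eq_integral_toReal_smul hq.ennreal_ofReal
      (ae_of_all _ fun _ => ENNReal.ofReal_lt_top)]
    simp only [hqq, smul_eq_mul]
  -- Nonnegativity of the divergence, from q log q ≥ q - 1.
  have hκ : 0 ≤ ∫ Υ, q Υ * Real.log (q Υ) ∂P := by
    have h : ∫ Υ, (q Υ - 1) ∂P ≤ ∫ Υ, q Υ * Real.log (q Υ) ∂P := by
      refine integral_mono (hqi.sub (integrable_const _)) hentP fun Υ => ?_
      rcases (hq0 Υ).eq_or_lt with h0 | h0
      · simp [← h0]
      · have h1 := Real.log_le_sub_one_of_pos (inv_pos.2 h0)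
        rw [Real.log_inv] at h1
        have h2 := mul_le_mul_of_nonneg_left h1 h0.le
        rw [mul_sub, mul_inv_cancel₀ h0.ne'] at h2
        simp only
        linarith
    rw [integral_sub hqi (integrable_const _), hq1] at h
    simpa using h
  set A : Set (𝒳 × Label) := {z | Real.sign (interpolator k (inputs S) v z.1) ≠ z.2}
  have hAm : MeasurableSet A := by
    refine (measurableSet_eq_fun (measurable_sign.comp ?_) (by fun_prop)).compl
    exact (measurable_interpolator hk_meas (inputs S)).comp
      (measurable_const.prodMk measurable_fst)
  have hhm := measurable_hitProb hk_meas (inputs S) hq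
  have hle1 : ∀ z, hitProb k (inputs S) q z ≤ 1 := fun z => by
    rw [hitProb_eq_of_withDensity hk_meas (inputs S) hq hq0 hB z]
    exact prob_le_one
  -- Integrated over D, the pointwise 1/e bound on the error set gives g + risk / e ≤ 1, that is,
  -- risk at most e times the Gibbs risk.
  have htot : ∫⁻ z, hitProb k (inputs S) q z ∂D + ENNReal.ofReal (Real.exp (-1)) * D A ≤ 1 := by
    calc _ = ∫⁻ z, (hitProb k (inputs S) q z +
          A.indicator (fun _ => ENNReal.ofReal (Real.exp (-1))) z) ∂D := by
          rw [lintegral_add_left hhm, lintegral_indicator_const hAm]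
      _ ≤ ∫⁻ _z, 1 ∂D := by
          refine lintegral_mono fun z => ?_
          by_cases hz : z ∈ A
          · simp only [Set.indicator_of_mem hz]
            exact hitProb_add_exp_neg_one_le hk_meas _ hq hq0 hC hCm hC0 hB hc hv z hz
          · simpa [Set.indicator_of_notMem hz] using hle1 z
      _ = 1 := by simp
  have hfin : ∫⁻ z, hitProb k (inputs S) q z ∂D ≠ ⊤ :=
    ne_top_of_le_ne_top ENNReal.one_ne_top (le_self_add.trans htot)
  set g := (∫⁻ z, hitProb k (inputs S) q z ∂D).toReal
  have hpb := pacBayes_of_ghostMass_le hk_meas hk S hu hq hq0 hqi hq1 hsupp hentP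
    (one_div_pos.2 hδ.1) hmass (g := g) ENNReal.toReal_nonneg (ENNReal.ofReal_toReal hfin).symm
  rw [← hentI]
  have hreal : g + Real.exp (-1) * D.real A ≤ 1 := by
    have h := ENNReal.toReal_mono ENNReal.one_ne_top htot
    rw [ENNReal.toReal_add hfin (ENNReal.mul_ne_top ENNReal.ofReal_ne_top (measure_ne_top _ _)),
      ENNReal.toReal_mul, ENNReal.toReal_ofReal (Real.exp_pos _).le, ENNReal.toReal_one] at h
    exact h
  refine le_riskBound_of_pacBayes hn (G := 1 - g) hδ.1 hκ hδ.2 measureReal_le_one ?_ ?_ ?_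
  · linarith [ENNReal.toReal_nonneg (a := ∫⁻ z, hitProb k (inputs S) q z ∂D)]
  · have h1 : Real.exp 1 * Real.exp (-1) = 1 := by rw [← Real.exp_add]; simp
    have h2 := mul_le_mul_of_nonneg_left hreal (Real.exp_pos 1).le
    rw [mul_add, ← mul_assoc, h1] at h2
    change D.real A ≤ _
    linarith
  · rw [sub_sub_cancel]
    exact hpb

end Posterior

/-! ### Moments of half-Gaussians and Gaussian changes of variables -/

section HalfGaussian

/-- The exponential cancels the Gaussian density and leaves Lebesgue measure up to a constant. In
several variables this lets two Gaussians of different covariance be compared through Lebesgue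
measure. -/
theorem lintegral_mul_exp_gaussianReal {G : ℝ → ℝ≥0∞} (hG : Measurable G) :
    ∫⁻ t, G t * ENNReal.ofReal (Real.exp (t ^ 2 / 2)) ∂gaussianReal 0 1 =
      ENNReal.ofReal (√(2 * Real.pi))⁻¹ * ∫⁻ t, G t := by
  rw [gaussianReal_of_var_ne_zero 0 one_ne_zero]
  refine (lintegral_withDensity_eq_lintegral_mul _ (measurable_gaussianPDF 0 1)
    (by fun_prop)).trans ?_
  rw [← lintegral_const_mul _ hG]
  refine lintegral_congr fun t => ?_
  have : gaussianPDF 0 1 t * ENNReal.ofReal (Real.exp (t ^ 2 / 2)) =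
      ENNReal.ofReal (√(2 * Real.pi))⁻¹ := by
    rw [gaussianPDF, ← ENNReal.ofReal_mul (gaussianPDFReal_nonneg _ _ _)]
    congr 1
    simp only [gaussianPDFReal, NNReal.coe_one, mul_one, sub_zero]
    rw [mul_assoc, ← Real.exp_add]
    ring_nf
    simp
  rw [← this, Pi.mul_apply]
  ring

theorem lintegral_mul_exp_pi_gaussianReal {m : ℕ} {F : (Fin m → ℝ) → ℝ≥0∞} (hF : Measurable F) :
    ∫⁻ v, F v * ENNReal.ofReal (Real.exp (v ⬝ᵥ v / 2)) ∂Measure.pi (fun _ => gaussianReal 0 1) =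
      ENNReal.ofReal (√(2 * Real.pi))⁻¹ ^ m * ∫⁻ v, F v := by
  induction m with
  | zero =>
    rw [volume_pi, Measure.pi_of_empty _ isEmptyElim, Measure.pi_of_empty _ isEmptyElim]
    simp
  | succ m ih =>
    have e1 := (measurePreserving_piFinSuccAbove
      (fun _ : Fin (m + 1) => gaussianReal 0 1) 0).symm
    have e2 := (volume_preserving_piFinSuccAbove (fun _ : Fin (m + 1) => ℝ) 0).symm
    have hcons : Measurable fun p : ℝ × (Fin m → ℝ) => (Fin.cons p.1 p.2 : Fin (m + 1) → ℝ) := by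
      refine measurable_pi_lambda _ fun i => ?_
      refine Fin.cases ?_ (fun j => ?_) i
      · simp only [Fin.cons_zero]; fun_prop
      · simp only [Fin.cons_succ]; fun_prop
    have hd : Measurable fun v : Fin (m + 1) → ℝ => F v *
        ENNReal.ofReal (Real.exp (v ⬝ᵥ v / 2)) := by
      simp only [dotProduct]; fun_prop
    have hFc : Measurable fun p : ℝ × (Fin m → ℝ) => F (Fin.cons p.1 p.2) := hF.comp hcons
    rw [← e1.lintegral_comp_emb (MeasurableEquiv.measurableEmbedding _),
      ← e2.lintegral_comp_emb (MeasurableEquiv.measurableEmbedding _), Measure.volume_eq_prod]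
    have hsymm : ∀ p : ℝ × (Fin m → ℝ), (MeasurableEquiv.piFinSuccAbove
        (fun _ : Fin (m + 1) => ℝ) 0).symm p = Fin.cons p.1 p.2 := fun p => by
      simp [MeasurableEquiv.piFinSuccAbove, Fin.insertNthEquiv, Fin.insertNth_zero']
    simp only [hsymm]
    rw [lintegral_prod (fun p : ℝ × (Fin m → ℝ) => _ * ENNReal.ofReal _)
      (hd.comp hcons).aemeasurable, lintegral_prod _ hFc.aemeasurable]
    have hinner : ∀ t : ℝ, ∫⁻ w : Fin m → ℝ, F (Fin.cons t w) * ENNReal.ofReal (Real.exp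
        ((Fin.cons t w : Fin (m + 1) → ℝ) ⬝ᵥ (Fin.cons t w : Fin (m + 1) → ℝ) / 2))
        ∂Measure.pi (fun _ => gaussianReal 0 1) =
        (ENNReal.ofReal (√(2 * Real.pi))⁻¹ ^ m * ∫⁻ w, F (Fin.cons t w)) *
          ENNReal.ofReal (Real.exp (t ^ 2 / 2)) := by
      intro t
      have hFt : Measurable fun w : Fin m → ℝ => F (Fin.cons t w) :=
        hFc.comp measurable_prodMk_left
      rw [← ih hFt, ← lintegral_mul_const _ (by simp only [dotProduct]; fun_prop)]
      refine lintegral_congr fun w => ?_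
      rw [mul_assoc, ← ENNReal.ofReal_mul (Real.exp_pos _).le, ← Real.exp_add]
      congr 3
      simp only [dotProduct, Fin.sum_univ_succ, Fin.cons_zero, Fin.cons_succ]
      ring
    have hFi : Measurable fun t : ℝ => ∫⁻ w : Fin m → ℝ, F (Fin.cons t w) :=
      hFc.lintegral_prod_right'
    change ∫⁻ t, ∫⁻ w : Fin m → ℝ, F (Fin.cons t w) * ENNReal.ofReal (Real.exp
        ((Fin.cons t w : Fin (m + 1) → ℝ) ⬝ᵥ (Fin.cons t w : Fin (m + 1) → ℝ) / 2))
        ∂Measure.pi (fun _ => gaussianReal 0 1) ∂gaussianReal 0 1 = _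
    simp only [hinner]
    rw [lintegral_mul_exp_gaussianReal (hFi.const_mul _), lintegral_const_mul _ hFi, ← mul_assoc,
      pow_succ']

/-- Gaussian change of variables under an invertible matrix. -/
theorem lintegral_mulVec_mul_exp_pi_gaussianReal {m : ℕ} {F : (Fin m → ℝ) → ℝ≥0∞}
    (hF : Measurable F) {M : Matrix (Fin m) (Fin m) ℝ} (hM : M.det ≠ 0) :
    ∫⁻ v, F (M *ᵥ v) * ENNReal.ofReal (Real.exp (v ⬝ᵥ v / 2))
        ∂Measure.pi (fun _ => gaussianReal 0 1) =
      ENNReal.ofReal (√(2 * Real.pi))⁻¹ ^ m * (ENNReal.ofReal |M.det⁻¹| * ∫⁻ v, F v) := by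
  have hm : Measurable fun v : Fin m → ℝ => M *ᵥ v := by
    refine measurable_pi_lambda _ fun i => ?_
    simp only [Matrix.mulVec, dotProduct]; fun_prop
  refine (lintegral_mul_exp_pi_gaussianReal (hF.comp hm)).trans ?_
  congr 1
  have h := Real.map_matrix_volume_pi_eq_smul_volume_pi hM
  have h2 := lintegral_map (μ := (volume : Measure (Fin m → ℝ))) hF hm
  change ∫⁻ v, F v ∂Measure.map (Matrix.toLin' M) volume = _ at h2
  rw [h, lintegral_smul_measure, smul_eq_mul] at h2
  exact h2.symm

theorem measurePreserving_label_mul (y : Label) :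
    MeasurePreserving (fun x : ℝ => (y : ℝ) * x) (gaussianReal 0 1) (gaussianReal 0 1) := by
  refine ⟨by fun_prop, ?_⟩
  rw [gaussianReal_map_const_mul]
  have : NNReal.mk ((y : ℝ) ^ 2) (sq_nonneg _) = 1 := by
    obtain ⟨y, rfl | rfl⟩ := y <;> ext <;> simp
  rw [this]; simp

theorem label_mul_self (y : Label) : (y : ℝ) * y = 1 := by
  obtain ⟨y, rfl | rfl⟩ := y <;> simp

theorem setIntegral_label_mul_pos (y : Label) (f : ℝ → ℝ) :
    ∫ x in {x | 0 < (y : ℝ) * x}, f x ∂gaussianReal 0 1 =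
      ∫ x in Set.Ioi 0, f (y * x) ∂gaussianReal 0 1 := by
  have hy : (y : ℝ) ≠ 0 := fun h => by have := label_mul_self y; simp [h] at this
  have hemb : MeasurableEmbedding fun x : ℝ => (y : ℝ) * x :=
    (MeasurableEquiv.mulLeft₀ (y : ℝ) hy).measurableEmbedding
  have h := (measurePreserving_label_mul y).setIntegral_preimage_emb hemb f {x | 0 < (y : ℝ) * x}
  rw [← h]
  congr 2
  ext x
  simp [← mul_assoc, label_mul_self]

theorem setIntegral_Ioi_of_even {f : ℝ → ℝ} (hf : ∀ x, f (-x) = f x)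
    (hi : Integrable f (gaussianReal 0 1)) :
    ∫ x in Set.Ioi 0, f x ∂gaussianReal 0 1 = (∫ x, f x ∂gaussianReal 0 1) / 2 := by
  have := nullSingletonClass_gaussianReal (μ := 0) (v := 1) one_ne_zero
  have h := integral_add_compl (measurableSet_Ioi (a := (0 : ℝ))) hi
  rw [Set.compl_Ioi, integral_Iic_eq_integral_Iio] at h
  have h2 := setIntegral_label_mul_pos ⟨-1, Or.inr rfl⟩ f
  have h3 : {x : ℝ | 0 < (((⟨-1, Or.inr rfl⟩ : Label) : ℝ)) * x} = Set.Iio 0 := by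
    ext x; simp
  rw [h3] at h2
  simp only [neg_one_mul, hf] at h2
  linarith

theorem gaussianReal_label_mul_pos (y : Label) :
    gaussianReal 0 1 {x | 0 < (y : ℝ) * x} = 2⁻¹ := by
  have h := setIntegral_label_mul_pos y fun _ => 1
  rw [setIntegral_Ioi_of_even (fun _ => rfl) (integrable_const _)] at h
  simp only [integral_const, measureReal_restrict_apply_univ, probReal_univ, smul_eq_mul,
    mul_one] at h
  rw [← ofReal_measureReal, h, one_div, ENNReal.ofReal_inv_of_pos two_pos, ENNReal.ofReal_ofNat]

theorem integrable_sq_gaussianReal : Integrable (fun x : ℝ => x ^ 2) (gaussianReal 0 1) :=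
  (IsGaussian.memLp_two_id (μ := gaussianReal 0 1)).integrable_sq

theorem integral_sq_gaussianReal : ∫ x, x ^ 2 ∂gaussianReal 0 1 = 1 := by
  have h := variance_id_gaussianReal (μ := 0) (v := 1)
  rw [variance_eq_sub IsGaussian.memLp_two_id] at h
  simpa using h

theorem setIntegral_Ioi_id_gaussianReal :
    ∫ x in Set.Ioi 0, x ∂gaussianReal 0 1 = (√(2 * Real.pi))⁻¹ := by
  rw [gaussianReal_of_var_ne_zero 0 one_ne_zero,
    setIntegral_withDensity_eq_setIntegral_toReal_smul (measurable_gaussianPDF 0 1)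
      (ae_of_all _ fun _ => ENNReal.ofReal_lt_top) _ measurableSet_Ioi]
  have h := integral_rpow_mul_exp_neg_mul_rpow (p := 2) (q := 1) (b := 1 / 2) two_pos
    (by norm_num) (by norm_num)
  have h2 : ∫ x in Set.Ioi (0 : ℝ), x ^ (1 : ℝ) * Real.exp (-(1 / 2) * x ^ (2 : ℝ)) = 1 := by
    rw [h]
    norm_num
  calc _ = ∫ x in Set.Ioi (0 : ℝ), (√(2 * Real.pi))⁻¹ *
        (x ^ (1 : ℝ) * Real.exp (-(1 / 2) * x ^ (2 : ℝ))) := by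
        refine setIntegral_congr_fun measurableSet_Ioi fun x _ => ?_
        simp only [toReal_gaussianPDF, gaussianPDFReal, NNReal.coe_one, mul_one, sub_zero,
          smul_eq_mul, Real.rpow_one, Real.rpow_ofNat]
        rw [mul_assoc, mul_comm x]
        congr 3
        ring
    _ = _ := by rw [integral_const_mul, h2, mul_one]

/-- The standard Gaussian conditioned on having the sign `y`. -/
noncomputable def halfGaussian (y : Label) : Measure ℝ :=
  (gaussianReal 0 1)[|{x | 0 < (y : ℝ) * x}]

instance isProbabilityMeasure_halfGaussian (y : Label) : IsProbabilityMeasure (halfGaussian y) :=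
  cond_isProbabilityMeasure (by rw [gaussianReal_label_mul_pos]; simp)

theorem integral_halfGaussian (y : Label) (f : ℝ → ℝ) :
    ∫ x, f x ∂halfGaussian y = 2 * ∫ x in Set.Ioi 0, f (y * x) ∂gaussianReal 0 1 := by
  rw [halfGaussian, ProbabilityTheory.cond, integral_smul_measure, gaussianReal_label_mul_pos,
    setIntegral_label_mul_pos]
  simp

theorem integral_id_halfGaussian (y : Label) :
    ∫ x, x ∂halfGaussian y = 2 * (√(2 * Real.pi))⁻¹ * y := by
  rw [integral_halfGaussian, integral_const_mul, setIntegral_Ioi_id_gaussianReal]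
  ring

theorem integral_sq_halfGaussian (y : Label) : ∫ x, x ^ 2 ∂halfGaussian y = 1 := by
  rw [integral_halfGaussian y fun x => x ^ 2]
  simp only [mul_pow, sq (y : ℝ), label_mul_self, one_mul]
  rw [setIntegral_Ioi_of_even (fun x => by ring) integrable_sq_gaussianReal,
    integral_sq_gaussianReal]
  norm_num

theorem integrable_halfGaussian (y : Label) {f : ℝ → ℝ} (hf : Integrable f (gaussianReal 0 1)) :
    Integrable f (halfGaussian y) :=
  (hf.restrict).smul_measure (by rw [gaussianReal_label_mul_pos]; simp)

variable {n : ℕ} (y : Fin n → Label)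

theorem pi_gaussianReal_orthant :
    Measure.pi (fun _ : Fin n => gaussianReal 0 1) {ξ | ∀ i, 0 < (y i : ℝ) * ξ i} = 2⁻¹ ^ n := by
  have : {ξ : Fin n → ℝ | ∀ i, 0 < (y i : ℝ) * ξ i} =
      Set.univ.pi fun i => {x | 0 < (y i : ℝ) * x} := by
    ext; simp
  rw [this, Measure.pi_pi]
  simp [gaussianReal_label_mul_pos]

/-- An orthant is a product set, so conditioning a product measure on it conditions each coordinate
separately. -/
theorem cond_pi_gaussianReal_orthant :
    (Measure.pi (fun _ : Fin n => gaussianReal 0 1))[|{ξ | ∀ i, 0 < (y i : ℝ) * ξ i}] =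
      Measure.pi fun i => halfGaussian (y i) := by
  refine (Measure.pi_eq fun s hs => ?_).symm
  have hm : MeasurableSet {ξ : Fin n → ℝ | ∀ i, 0 < (y i : ℝ) * ξ i} := by
    have : {ξ : Fin n → ℝ | ∀ i, 0 < (y i : ℝ) * ξ i} = ⋂ i, {ξ | 0 < (y i : ℝ) * ξ i} := by
      ext; simp
    rw [this]
    exact MeasurableSet.iInter fun i => measurableSet_lt measurable_const (by fun_prop)
  have hinter : {ξ : Fin n → ℝ | ∀ i, 0 < (y i : ℝ) * ξ i} ∩ Set.univ.pi s =
      Set.univ.pi fun i => {x | 0 < (y i : ℝ) * x} ∩ s i := by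
    ext ξ; simp [forall_and]
  rw [cond_apply hm, pi_gaussianReal_orthant, hinter, Measure.pi_pi]
  have h1 : ∀ i, halfGaussian (y i) (s i) =
      2 * gaussianReal 0 1 ({x | 0 < (y i : ℝ) * x} ∩ s i) := fun i => by
    rw [halfGaussian, cond_apply (measurableSet_lt measurable_const (by fun_prop)),
      gaussianReal_label_mul_pos, inv_inv]
  simp only [h1, Finset.prod_mul_distrib]
  simp [ENNReal.inv_pow]

theorem integrable_eval_halfGaussian (i : Fin n) :
    Integrable (fun ξ : Fin n → ℝ => ξ i) (Measure.pi fun i => halfGaussian (y i)) :=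
  integrable_eval (i := i) (integrable_halfGaussian (y i) IsGaussian.integrable_id)

theorem integral_eval_halfGaussian (i : Fin n) :
    ∫ ξ : Fin n → ℝ, ξ i ∂Measure.pi (fun i => halfGaussian (y i)) =
      2 * (√(2 * Real.pi))⁻¹ * y i := by
  rw [integral_comp_eval (μ := fun i => halfGaussian (y i)) (f := fun x => x) (by fun_prop),
    integral_id_halfGaussian]

theorem integral_eval_mul_eval_halfGaussian (i j : Fin n) :
    Integrable (fun ξ : Fin n → ℝ => ξ i * ξ j) (Measure.pi fun i => halfGaussian (y i)) ∧
    ∫ ξ : Fin n → ℝ, ξ i * ξ j ∂Measure.pi (fun i => halfGaussian (y i)) =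
      if i = j then 1 else 2 / Real.pi * (y i * y j) := by
  split_ifs with h
  · subst h
    simp only [← sq]
    refine ⟨integrable_comp_eval (μ := fun i => halfGaussian (y i)) (i := i) (f := fun x : ℝ => x ^ 2)
      (integrable_halfGaussian (y i) integrable_sq_gaussianReal), ?_⟩
    rw [integral_comp_eval (μ := fun i => halfGaussian (y i)) (f := fun x => x ^ 2) (by fun_prop),
      integral_sq_halfGaussian]
  · have hind : IndepFun (fun ξ : Fin n → ℝ => ξ i) (fun ξ => ξ j)
        (Measure.pi fun i => halfGaussian (y i)) :=
      (iIndepFun_pi (μ := fun i => halfGaussian (y i)) (X := fun _ x => x)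
        (fun _ => aemeasurable_id)).indepFun h
    refine ⟨hind.integrable_mul (integrable_eval_halfGaussian y i)
      (integrable_eval_halfGaussian y j), ?_⟩
    have hm := hind.integral_mul_eq_mul_integral
      (integrable_eval_halfGaussian y i).aestronglyMeasurable
      (integrable_eval_halfGaussian y j).aestronglyMeasurable
    refine hm.trans ?_
    rw [integral_eval_halfGaussian, integral_eval_halfGaussian]
    have h2 : (√(2 * Real.pi))⁻¹ * (√(2 * Real.pi))⁻¹ = (2 * Real.pi)⁻¹ := by
      rw [← mul_inv, Real.mul_self_sqrt (by positivity)]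
    calc _ = 4 * ((√(2 * Real.pi))⁻¹ * (√(2 * Real.pi))⁻¹) * (y i * y j) := by ring
      _ = _ := by rw [h2]; field_simp; ring

/-- The second-moment matrix is (1 - 2/π) I + (2/π) Y Yᵀ: each coordinate has second moment 1 and
mean √(2/π) times its label, distinct coordinates are independent, and labels square to one. This is
the origin of the constants in the complexity. -/
theorem integral_quadraticForm_halfGaussian (A : Matrix (Fin n) (Fin n) ℝ) :
    Integrable (fun ξ : Fin n → ℝ => ξ ⬝ᵥ A *ᵥ ξ) (Measure.pi fun i => halfGaussian (y i)) ∧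
    ∫ ξ : Fin n → ℝ, ξ ⬝ᵥ A *ᵥ ξ ∂Measure.pi (fun i => halfGaussian (y i)) =
      (1 - 2 / Real.pi) * A.trace +
        2 / Real.pi * ((fun i => (y i : ℝ)) ⬝ᵥ A *ᵥ fun i => (y i : ℝ)) := by
  have h : ∀ ξ : Fin n → ℝ, ξ ⬝ᵥ A *ᵥ ξ = ∑ i, ∑ j, A i j * (ξ i * ξ j) := by
    intro ξ
    simp only [dotProduct, Matrix.mulVec, Finset.mul_sum]
    exact Finset.sum_congr rfl fun i _ => Finset.sum_congr rfl fun j _ => by ring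
  have hi : ∀ i j, Integrable (fun ξ : Fin n → ℝ => A i j * (ξ i * ξ j))
      (Measure.pi fun i => halfGaussian (y i)) :=
    fun i j => (integral_eval_mul_eval_halfGaussian y i j).1.const_mul _
  simp only [h]
  refine ⟨integrable_finsetSum _ fun i _ => integrable_finsetSum _ fun j _ => hi i j, ?_⟩
  rw [integral_finsetSum _ fun i _ => integrable_finsetSum _ fun j _ => hi i j]
  simp_rw [integral_finsetSum _ fun j _ => hi _ j, integral_const_mul,
    (integral_eval_mul_eval_halfGaussian y _ _).2]
  have hterm : ∀ i j, A i j * (if i = j then 1 else 2 / Real.pi * ((y i : ℝ) * y j)) =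
      (if i = j then (1 - 2 / Real.pi) * A i j else 0) +
        2 / Real.pi * (A i j * ((y i : ℝ) * y j)) := by
    intro i j
    split_ifs with hij
    · subst hij
      rw [label_mul_self]; ring
    · ring
  simp only [hterm, Finset.sum_add_distrib, Finset.sum_ite_eq, Finset.mem_univ, if_true,
    ← Finset.mul_sum, Matrix.trace, Matrix.diag_apply]

theorem integral_linearMap_halfGaussian (L : (Fin n → ℝ) →ₗ[ℝ] ℝ) :
    ∫ ξ, L ξ ∂Measure.pi (fun i => halfGaussian (y i)) =
      2 * (√(2 * Real.pi))⁻¹ * L fun i => (y i : ℝ) := by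
  have h : ∀ ξ, L ξ = ∑ i, ξ i * L (Pi.single i 1) := by
    intro ξ
    rw [LinearMap.pi_apply_eq_sum_univ L ξ]
    refine Finset.sum_congr rfl fun i _ => ?_
    simp only [smul_eq_mul]
    congr 2
    ext j
    simp [Pi.single_apply, eq_comm]
  rw [integral_congr_ae (ae_of_all _ h), h]
  rw [integral_finsetSum _ fun i _ => (integrable_eval_halfGaussian y i).mul_const _]
  simp_rw [integral_mul_const, integral_eval_halfGaussian, mul_assoc, ← Finset.mul_sum]

end HalfGaussian

/-! ### The spherical posterior, the conditioned prior and their divergences -/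

section Posteriors

variable {𝒳 : Type*} {n : ℕ} {k : 𝒳 → 𝒳 → ℝ}

/-- The linear map carrying standard Gaussian noise to the Gaussian process prior. -/
noncomputable def priorLin (k : 𝒳 → 𝒳 → ℝ) (X : Fin n → 𝒳) :
    (Fin n → ℝ) →ₗ[ℝ] EuclideanSpace ℝ (Fin n) :=
  (Matrix.toEuclideanCLM (𝕜 := ℝ) (CFC.sqrt (gramMatrix k X))).toLinearMap ∘ₗ
    (WithLp.linearEquiv 2 ℝ (Fin n → ℝ)).symm.toLinearMap

theorem priorLin_ofLp (X : Fin n → 𝒳) (ξ : Fin n → ℝ) :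
    (priorLin k X ξ).ofLp = CFC.sqrt (gramMatrix k X) *ᵥ ξ :=
  Matrix.ofLp_toEuclideanCLM _ _

theorem measurable_priorLin (X : Fin n → 𝒳) : Measurable (priorLin k X) :=
  (priorLin k X).continuous_of_finiteDimensional.measurable

theorem map_priorLin (X : Fin n → 𝒳) :
    (Measure.pi fun _ : Fin n => gaussianReal 0 1).map (priorLin k X) = gpPrior k X := by
  rw [gpPrior, multivariateGaussian, ← map_pi_eq_stdGaussian,
    Measure.map_map (by fun_prop) (by fun_prop)]
  simp only [zero_add]
  rfl

theorem gramMatrix_det_pos (hk : (Matrix.of k : Matrix 𝒳 𝒳 ℝ).PosSemidef) {X : Fin n → 𝒳}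
    (hu : IsUnit (gramMatrix k X)) : 0 < (gramMatrix k X).det :=
  (gram_posSemidef hk X).det_nonneg.lt_of_ne'
    ((Matrix.isUnit_iff_isUnit_det _).1 hu).ne_zero

theorem sqrt_gramMatrix_mul_self (hk : (Matrix.of k : Matrix 𝒳 𝒳 ℝ).PosSemidef)
    (X : Fin n → 𝒳) : CFC.sqrt (gramMatrix k X) * CFC.sqrt (gramMatrix k X) = gramMatrix k X :=
  CFC.sqrt_mul_sqrt_self _ (gram_posSemidef hk X).nonneg

theorem sqrt_gramMatrix_det_sq (hk : (Matrix.of k : Matrix 𝒳 𝒳 ℝ).PosSemidef)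
    (X : Fin n → 𝒳) : (CFC.sqrt (gramMatrix k X)).det ^ 2 = (gramMatrix k X).det := by
  rw [sq, ← Matrix.det_mul, sqrt_gramMatrix_mul_self hk]

theorem sqrt_gramMatrix_dotProduct (hk : (Matrix.of k : Matrix 𝒳 𝒳 ℝ).PosSemidef)
    {X : Fin n → 𝒳} (hu : IsUnit (gramMatrix k X)) (ξ : Fin n → ℝ) :
    (CFC.sqrt (gramMatrix k X) *ᵥ ξ) ⬝ᵥ
      ((gramMatrix k X)⁻¹ *ᵥ (CFC.sqrt (gramMatrix k X) *ᵥ ξ)) = ξ ⬝ᵥ ξ := by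
  set A := CFC.sqrt (gramMatrix k X)
  have hAA : A * A = gramMatrix k X := sqrt_gramMatrix_mul_self hk X
  have hA : IsUnit A.det := by
    refine isUnit_iff_ne_zero.2 fun h => ?_
    have h2 := sqrt_gramMatrix_det_sq hk X
    have h3 := gramMatrix_det_pos hk hu
    rw [show (CFC.sqrt (gramMatrix k X)).det = 0 from h] at h2
    simp [← h2] at h3
  have hT : Aᵀ = A := by
    have h : IsSelfAdjoint A := (CFC.sqrt_nonneg (gramMatrix k X)).isSelfAdjoint
    rwa [IsSelfAdjoint, Matrix.star_eq_conjTranspose,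
      Matrix.conjTranspose_eq_transpose_of_trivial] at h
  have h1 : A * ((gramMatrix k X)⁻¹ * A) = 1 := by
    rw [← hAA, Matrix.mul_inv_rev, Matrix.mul_assoc, Matrix.nonsing_inv_mul _ hA, Matrix.mul_one,
      Matrix.mul_nonsing_inv _ hA]
  rw [Matrix.mulVec_mulVec, ← hT, ← Matrix.vecMul_transpose, hT, hT, ← Matrix.dotProduct_mulVec,
    Matrix.mulVec_mulVec, h1, Matrix.one_mulVec]

/-- Standard deviation of the spherical posterior. -/
noncomputable def sphScale (k : 𝒳 → 𝒳 → ℝ) (X : Fin n → 𝒳) : ℝ :=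
  √((gramMatrix k X).det ^ (1 / (n : ℝ)))

/-- The linear map carrying standard Gaussian noise to the spherical Gaussian. -/
noncomputable def sphLin (k : 𝒳 → 𝒳 → ℝ) (X : Fin n → 𝒳) :
    (Fin n → ℝ) →ₗ[ℝ] EuclideanSpace ℝ (Fin n) :=
  sphScale k X • (WithLp.linearEquiv 2 ℝ (Fin n → ℝ)).symm.toLinearMap

theorem sphLin_ofLp (X : Fin n → 𝒳) (ξ : Fin n → ℝ) :
    (sphLin k X ξ).ofLp = sphScale k X • ξ := rfl

/-- Density with respect to the Gaussian process prior of the spherical Gaussian restricted to the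
orthant of the labels. -/
noncomputable def sphDensity (k : 𝒳 → 𝒳 → ℝ) (S : Fin n → 𝒳 × Label) :
    EuclideanSpace ℝ (Fin n) → ℝ :=
  (orthant (labels S)).indicator fun Υ =>
    2 ^ n * Real.exp (Υ.ofLp ⬝ᵥ ((gramMatrix k (inputs S))⁻¹ *ᵥ Υ.ofLp) / 2 -
      Υ.ofLp ⬝ᵥ Υ.ofLp / (2 * sphScale k (inputs S) ^ 2))

theorem sphScale_pos (hk : (Matrix.of k : Matrix 𝒳 𝒳 ℝ).PosSemidef) {X : Fin n → 𝒳}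
    (hu : IsUnit (gramMatrix k X)) : 0 < sphScale k X :=
  Real.sqrt_pos.2 (Real.rpow_pos_of_pos (gramMatrix_det_pos hk hu) _)

theorem sphScale_sq (hk : (Matrix.of k : Matrix 𝒳 𝒳 ℝ).PosSemidef) {X : Fin n → 𝒳}
    (hu : IsUnit (gramMatrix k X)) :
    sphScale k X ^ 2 = (gramMatrix k X).det ^ (1 / (n : ℝ)) :=
  Real.sq_sqrt (Real.rpow_pos_of_pos (gramMatrix_det_pos hk hu) _).le

/-- The scale is chosen so that spherical Gaussian and prior have equal covariance determinants.
Hence no determinant factor appears in `sphDensity` and no log-determinant in the divergence. -/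
theorem abs_det_sqrt_gramMatrix (hk : (Matrix.of k : Matrix 𝒳 𝒳 ℝ).PosSemidef) {X : Fin n → 𝒳}
    (hn : n ≠ 0) (hu : IsUnit (gramMatrix k X)) :
    |(CFC.sqrt (gramMatrix k X)).det| = sphScale k X ^ n := by
  refine (sq_eq_sq₀ (abs_nonneg _) (pow_nonneg (sphScale_pos hk hu).le _)).1 ?_
  rw [sq_abs, sqrt_gramMatrix_det_sq hk, ← pow_mul, mul_comm, pow_mul, sphScale_sq hk hu, one_div,
    Real.rpow_inv_natCast_pow (gramMatrix_det_pos hk hu).le hn]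

theorem measurable_sphDensity (S : Fin n → 𝒳 × Label) : Measurable (sphDensity k S) := by
  refine Measurable.indicator ?_ (measurableSet_orthant_labels S)
  have h : Measurable fun Υ : EuclideanSpace ℝ (Fin n) =>
      (gramMatrix k (inputs S))⁻¹ *ᵥ Υ.ofLp := by
    refine measurable_pi_lambda _ fun i => ?_
    simp only [Matrix.mulVec, dotProduct]; fun_prop
  simp only [dotProduct]
  fun_prop

theorem sphDensity_nonneg (S : Fin n → 𝒳 × Label) (Υ : EuclideanSpace ℝ (Fin n)) :
    0 ≤ sphDensity k S Υ :=
  Set.indicator_nonneg (fun _ _ => by positivity) _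

theorem preimage_sphLin_orthant (hk : (Matrix.of k : Matrix 𝒳 𝒳 ℝ).PosSemidef)
    (S : Fin n → 𝒳 × Label) (hu : IsUnit (gramMatrix k (inputs S))) :
    sphLin k (inputs S) ⁻¹' orthant (labels S) = {ξ | ∀ i, 0 < ((S i).2 : ℝ) * ξ i} := by
  ext ξ
  rw [orthant_labels]
  refine forall_congr' fun i => ?_
  change 0 < ((S i).2 : ℝ) * (sphScale k (inputs S) * ξ i) ↔ _
  rw [mul_left_comm]
  exact mul_pos_iff_of_pos_left (sphScale_pos hk hu)

/-- Both measures are integrals of one function `F` along an invertible linear image of standard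
Gaussian noise, corrected by exp(|ξ|²/2). By `lintegral_mulVec_mul_exp_pi_gaussianReal` such
integrals depend on the linear map only through its determinant, and the two determinants agree in
absolute value. -/
theorem withDensity_sphDensity (hk : (Matrix.of k : Matrix 𝒳 𝒳 ℝ).PosSemidef) (hn : n ≠ 0)
    (S : Fin n → 𝒳 × Label) (hu : IsUnit (gramMatrix k (inputs S))) :
    (gpPrior k (inputs S)).withDensity (fun Υ => ENNReal.ofReal (sphDensity k S Υ)) =
      ((Measure.pi fun _ : Fin n => gaussianReal 0 1)[|{ξ | ∀ i, 0 < ((S i).2 : ℝ) * ξ i}]).map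
        (sphLin k (inputs S)) := by
  set X := inputs S
  set σ := sphScale k X
  have hσ : 0 < σ := sphScale_pos hk hu
  set C : Set (Fin n → ℝ) := {ξ | ∀ i, 0 < ((S i).2 : ℝ) * ξ i}
  have hpre : sphLin k X ⁻¹' orthant (labels S) = C := preimage_sphLin_orthant hk S hu
  have hOm := measurableSet_orthant_labels S
  have hBm : Measurable (sphLin k X) := (sphLin k X).continuous_of_finiteDimensional.measurable
  have hCm : MeasurableSet C := hpre ▸ hBm hOm
  ext A hA
  set F : (Fin n → ℝ) → ℝ≥0∞ := fun w =>
    (A ∩ orthant (labels S)).indicator (fun _ => (2 : ℝ≥0∞) ^ n) (WithLp.toLp 2 w) *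
      ENNReal.ofReal (Real.exp (-(w ⬝ᵥ w / (2 * σ ^ 2))))
  have hF : Measurable F := by
    refine Measurable.mul ?_ (by simp only [dotProduct]; fun_prop)
    exact (measurable_const.indicator (hA.inter hOm)).comp (WithLp.measurable_toLp 2 _)
  have hdet : (CFC.sqrt (gramMatrix k X)).det ≠ 0 := by
    rw [← abs_pos, abs_det_sqrt_gramMatrix hk hn hu]
    exact pow_pos hσ n
  have h1 := lintegral_mulVec_mul_exp_pi_gaussianReal hF hdet
  have hdet2 : (σ • (1 : Matrix (Fin n) (Fin n) ℝ)).det = σ ^ n := by simp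
  have h2 := lintegral_mulVec_mul_exp_pi_gaussianReal hF
    (M := σ • (1 : Matrix (Fin n) (Fin n) ℝ)) (by rw [hdet2]; exact (pow_pos hσ n).ne')
  rw [hdet2, abs_inv, abs_of_pos (pow_pos hσ n)] at h2
  rw [abs_inv, abs_det_sqrt_gramMatrix hk hn hu] at h1
  have h3 := h1.trans h2.symm
  rw [withDensity_apply _ hA, ← lintegral_indicator hA, ← map_priorLin,
    lintegral_map ((measurable_sphDensity S).ennreal_ofReal.indicator hA) (measurable_priorLin _)]
  calc _ = ∫⁻ ξ, F (CFC.sqrt (gramMatrix k X) *ᵥ ξ) * ENNReal.ofReal (Real.exp (ξ ⬝ᵥ ξ / 2))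
        ∂Measure.pi (fun _ => gaussianReal 0 1) := by
        refine lintegral_congr fun ξ => ?_
        have hto : priorLin k X ξ = WithLp.toLp 2 (CFC.sqrt (gramMatrix k X) *ᵥ ξ) := by
          rw [← priorLin_ofLp]
        simp only [F, ← hto]
        by_cases hξ : priorLin k X ξ ∈ A ∩ orthant (labels S)
        · rw [Set.indicator_of_mem hξ, Set.indicator_of_mem hξ.1, sphDensity,
            Set.indicator_of_mem hξ.2, priorLin_ofLp, sqrt_gramMatrix_dotProduct hk hu, mul_assoc,
            ← ENNReal.ofReal_mul (Real.exp_pos _).le, ← Real.exp_add,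
            ENNReal.ofReal_mul (by positivity), ENNReal.ofReal_pow two_pos.le, ENNReal.ofReal_ofNat]
          congr 3
          ring
        · rw [Set.indicator_of_notMem hξ, zero_mul, zero_mul]
          by_cases hξA : priorLin k X ξ ∈ A
          · rw [Set.indicator_of_mem hξA, sphDensity,
              Set.indicator_of_notMem fun h => hξ ⟨hξA, h⟩, ENNReal.ofReal_zero]
          · rw [Set.indicator_of_notMem hξA]
    _ = _ := h3
    _ = ∫⁻ ξ, (sphLin k X ⁻¹' (A ∩ orthant (labels S))).indicator (fun _ => (2 : ℝ≥0∞) ^ n) ξ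
        ∂Measure.pi (fun _ => gaussianReal 0 1) := by
        refine lintegral_congr fun ξ => ?_
        have hto : WithLp.toLp 2 ((σ • (1 : Matrix (Fin n) (Fin n) ℝ)) *ᵥ ξ) = sphLin k X ξ := by
          rw [Matrix.smul_mulVec, Matrix.one_mulVec]; rfl
        simp only [F, hto]
        rw [mul_assoc, ← ENNReal.ofReal_mul (Real.exp_pos _).le, ← Real.exp_add,
          Matrix.smul_mulVec, Matrix.one_mulVec, dotProduct_smul, smul_dotProduct]
        have : -(σ • σ • (ξ ⬝ᵥ ξ) / (2 * σ ^ 2)) + ξ ⬝ᵥ ξ / 2 = 0 := by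
          simp only [smul_eq_mul]; field_simp; ring
        rw [this, Real.exp_zero, ENNReal.ofReal_one, mul_one]
        rfl
    _ = _ := by
        rw [lintegral_indicator_const (hBm (hA.inter hOm)), Measure.map_apply hBm hA,
          cond_apply hCm, pi_gaussianReal_orthant, Set.preimage_inter, hpre, Set.inter_comm,
          ENNReal.inv_pow, inv_inv]

/-- On the orthant the log-density is n log 2 + (σ²/2) ξᵀK⁻¹ξ - |ξ|²/2, with σ² = |K|^{1/n}. The
half-Gaussian moments of the two quadratic forms give the complexity, the last term contributing
-n/2. -/
theorem integral_log_sphDensity (hk : (Matrix.of k : Matrix 𝒳 𝒳 ℝ).PosSemidef)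
    (S : Fin n → 𝒳 × Label) (hu : IsUnit (gramMatrix k (inputs S))) :
    Integrable (fun ξ => Real.log (sphDensity k S (sphLin k (inputs S) ξ)))
      (Measure.pi fun _ : Fin n => gaussianReal 0 1)[|{ξ | ∀ i, 0 < ((S i).2 : ℝ) * ξ i}] ∧
    ∫ ξ, Real.log (sphDensity k S (sphLin k (inputs S) ξ))
      ∂(Measure.pi fun _ : Fin n => gaussianReal 0 1)[|{ξ | ∀ i, 0 < ((S i).2 : ℝ) * ξ i}] =
      complexity k (inputs S) (labels S) := by
  set X := inputs S
  set σ := sphScale k X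
  have hσ : 0 < σ := sphScale_pos hk hu
  have hσ2 : σ ^ 2 = (gramMatrix k X).det ^ (1 / (n : ℝ)) := sphScale_sq hk hu
  set C : Set (Fin n → ℝ) := {ξ | ∀ i, 0 < ((S i).2 : ℝ) * ξ i}
  have hpre : sphLin k X ⁻¹' orthant (labels S) = C := preimage_sphLin_orthant hk S hu
  have hCm : MeasurableSet C := hpre ▸
    (sphLin k X).continuous_of_finiteDimensional.measurable (measurableSet_orthant_labels S)
  have hae : (fun ξ => Real.log (sphDensity k S (sphLin k X ξ)))
      =ᵐ[(Measure.pi fun _ : Fin n => gaussianReal 0 1)[|C]] fun ξ =>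
        (n * Real.log 2 + σ ^ 2 / 2 * (ξ ⬝ᵥ (gramMatrix k X)⁻¹ *ᵥ ξ)) -
          1 / 2 * (ξ ⬝ᵥ (1 : Matrix (Fin n) (Fin n) ℝ) *ᵥ ξ) := by
    filter_upwards [ae_cond_mem hCm] with ξ hξ
    rw [← hpre] at hξ
    rw [sphDensity, Set.indicator_of_mem (Set.mem_preimage.1 hξ), Real.log_mul (by positivity) (Real.exp_ne_zero _),
      Real.log_pow, Real.log_exp, sphLin_ofLp, Matrix.mulVec_smul, dotProduct_smul,
      smul_dotProduct, dotProduct_smul, smul_dotProduct, Matrix.one_mulVec]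
    simp only [smul_eq_mul]
    change _ + (σ * (σ * _) / 2 - σ * (σ * _) / (2 * σ ^ 2)) = _
    field_simp
    ring
  have hcond : (Measure.pi fun _ : Fin n => gaussianReal 0 1)[|C] =
      Measure.pi fun i => halfGaussian (S i).2 := cond_pi_gaussianReal_orthant _
  rw [integral_congr_ae hae, integrable_congr hae, hcond]
  obtain ⟨i1, e1⟩ := integral_quadraticForm_halfGaussian (fun i => (S i).2) (gramMatrix k X)⁻¹
  obtain ⟨i2, e2⟩ := integral_quadraticForm_halfGaussian (fun i => (S i).2)
    (1 : Matrix (Fin n) (Fin n) ℝ)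
  have i3 : Integrable (fun ξ : Fin n → ℝ =>
      n * Real.log 2 + σ ^ 2 / 2 * (ξ ⬝ᵥ (gramMatrix k X)⁻¹ *ᵥ ξ))
      (Measure.pi fun i => halfGaussian (S i).2) := (integrable_const _).add (i1.const_mul _)
  refine ⟨i3.sub (i2.const_mul _), ?_⟩
  rw [integral_sub i3 (i2.const_mul _), integral_add (integrable_const _) (i1.const_mul _),
    integral_const_mul (σ ^ 2 / 2), integral_const_mul (1 / 2 : ℝ), e1, e2, hσ2]
  have hy : (fun i => ((S i).2 : ℝ)) ⬝ᵥ (1 : Matrix (Fin n) (Fin n) ℝ) *ᵥ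
      (fun i => ((S i).2 : ℝ)) = n := by
    simp [dotProduct, label_mul_self]
  rw [hy]
  simp only [integral_const, probReal_univ, one_smul, Matrix.trace_one, Fintype.card_fin,
    complexity]
  change _ = (n : ℝ) * (Real.log 2 - 1 / 2) + (gramMatrix k X).det ^ (1 / (n : ℝ)) *
    ((1 / 2 - 1 / Real.pi) * (gramMatrix k X)⁻¹.trace + 1 / Real.pi *
      ((fun i => ((S i).2 : ℝ)) ⬝ᵥ (gramMatrix k X)⁻¹ *ᵥ (fun i => ((S i).2 : ℝ))))
  ring

/-- The spherical posterior is absolutely continuous with respect to the prior and gives the orthant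
full mass. -/
theorem gpPrior_orthant_ne_zero (hk : (Matrix.of k : Matrix 𝒳 𝒳 ℝ).PosSemidef) (hn : n ≠ 0)
    (S : Fin n → 𝒳 × Label) (hu : IsUnit (gramMatrix k (inputs S))) :
    gpPrior k (inputs S) (orthant (labels S)) ≠ 0 := by
  intro h
  have h1 := withDensity_absolutelyContinuous (gpPrior k (inputs S))
    (fun Υ => ENNReal.ofReal (sphDensity k S Υ)) h
  have hC0 : Measure.pi (fun _ : Fin n => gaussianReal 0 1)
      {ξ | ∀ i, 0 < ((S i).2 : ℝ) * ξ i} ≠ 0 := by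
    rw [pi_gaussianReal_orthant]; simp
  have hBm := (sphLin k (inputs S)).continuous_of_finiteDimensional.measurable
  rw [withDensity_sphDensity hk hn S hu, Measure.map_apply hBm (measurableSet_orthant_labels S),
    preimage_sphLin_orthant hk S hu, cond_apply_self hC0 (measure_ne_top _ _)] at h1
  exact one_ne_zero h1

variable [MeasurableSpace 𝒳] {D : Measure (𝒳 × Label)} [IsProbabilityMeasure D]

/-- The spherical posterior has independent coordinates with means proportional to the labels, so
the interpolator of its mean is a positive multiple of `f_Y` and makes the same errors. -/
theorem risk_labels_le_riskBound (hk_meas : Measurable (Function.uncurry k))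
    (hk : (Matrix.of k : Matrix 𝒳 𝒳 ℝ).PosSemidef) (hn : 2 ≤ n) {δ : ℝ}
    (hδ : δ ∈ Set.Ioo (0 : ℝ) 1) (S : Fin n → 𝒳 × Label)
    (hu : IsUnit (gramMatrix k (inputs S)))
    (hmass : ghostMass k D n S ≤ ENNReal.ofReal (1 / δ)) :
    risk D (interpolator k (inputs S) (labels S)) ≤
      riskBound n δ (complexity k (inputs S) (labels S)) := by
  have hn0 : n ≠ 0 := by omega
  set C : Set (Fin n → ℝ) := {ξ | ∀ i, 0 < ((S i).2 : ℝ) * ξ i}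
  have hpre : sphLin k (inputs S) ⁻¹' orthant (labels S) = C := preimage_sphLin_orthant hk S hu
  have hCm : MeasurableSet C := hpre ▸ (sphLin k
    (inputs S)).continuous_of_finiteDimensional.measurable (measurableSet_orthant_labels S)
  have hC : Convex ℝ C := hpre ▸ (convex_orthant_labels S).linear_preimage (sphLin k (inputs S))
  have hC0 : Measure.pi (fun _ : Fin n => gaussianReal 0 1) C ≠ 0 := by
    rw [pi_gaussianReal_orthant]; simp
  obtain ⟨hi, he⟩ := integral_log_sphDensity hk S hu
  rw [← he]
  refine risk_le_riskBound_of_ghostMass hk_meas hk hn hδ S hu hmass (measurable_sphDensity S)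
    (sphDensity_nonneg S) (fun Υ h => Set.mem_of_indicator_ne_zero h) hC hCm hC0
    (withDensity_sphDensity hk hn0 S hu) hi
    -- The integral of σξ over the orthant, without normalisation, is this constant times Y; 2 /
    -- √(2π) is the mean of a positive half-Gaussian.
    (c := (Measure.pi fun _ : Fin n => gaussianReal 0 1).real C *
      (2 * (√(2 * Real.pi))⁻¹ * sphScale k (inputs S))) ?_ fun L => ?_
  · have := (sphScale_pos hk hu).le
    positivity
  · have h1 := integral_linearMap_halfGaussian (fun i => (S i).2) (L ∘ₗ sphLin k (inputs S))
    have h2 : (Measure.pi fun _ : Fin n => gaussianReal 0 1)[|C] =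
      Measure.pi fun i => halfGaussian (S i).2 := cond_pi_gaussianReal_orthant _
    rw [← h2, ProbabilityTheory.cond, integral_smul_measure, smul_eq_mul, ENNReal.toReal_inv,
      inv_mul_eq_iff_eq_mul₀ (ENNReal.toReal_ne_zero.2 ⟨hC0, measure_ne_top _ _⟩)] at h1
    refine h1.trans ?_
    have h3 : (L ∘ₗ sphLin k (inputs S)) (fun i => ((S i).2 : ℝ)) =
        sphScale k (inputs S) * L (WithLp.toLp 2 (labels S)) := by
      rw [← smul_eq_mul, ← map_smul]; rfl
    rw [h3, measureReal_def]
    ring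

/-- The conditioned prior has constant density 1 / P_Y on the orthant, hence divergence log(1 /
P_Y), and it is the image of standard Gaussian noise conditioned on the convex preimage of the
orthant. -/
theorem risk_comLabels_le_riskBound (hk_meas : Measurable (Function.uncurry k))
    (hk : (Matrix.of k : Matrix 𝒳 𝒳 ℝ).PosSemidef) (hn : 2 ≤ n) {δ : ℝ}
    (hδ : δ ∈ Set.Ioo (0 : ℝ) 1) (S : Fin n → 𝒳 × Label)
    (hu : IsUnit (gramMatrix k (inputs S)))
    (hmass : ghostMass k D n S ≤ ENNReal.ofReal (1 / δ)) :
    risk D (interpolator k (inputs S) (comLabels k (inputs S) (labels S))) ≤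
      riskBound n δ (Real.log (1 / orthantProb k (inputs S) (labels S))) := by
  set X := inputs S
  set O := orthant (labels S)
  set P := gpPrior k X
  have hO0 : P O ≠ 0 := gpPrior_orthant_ne_zero hk (by omega) S hu
  have hOm : MeasurableSet O := measurableSet_orthant_labels S
  have hBm := measurable_priorLin (k := k) X
  set γ := Measure.pi fun _ : Fin n => gaussianReal 0 1
  have hmap : γ.map (priorLin k X) = P := map_priorLin X
  set C : Set (Fin n → ℝ) := priorLin k X ⁻¹' O
  have hCm : MeasurableSet C := hBm hOm
  have hCO : γ C = P O := by rw [← hmap, Measure.map_apply hBm hOm]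
  have hC0 : γ C ≠ 0 := hCO ▸ hO0
  have : IsProbabilityMeasure γ[|C] := cond_isProbabilityMeasure hC0
  set p := orthantProb k X (labels S)
  have hp : 0 < p := ENNReal.toReal_pos hO0 (measure_ne_top _ _)
  set q : EuclideanSpace ℝ (Fin n) → ℝ := O.indicator fun _ => 1 / p
  have hpinv : ENNReal.ofReal (1 / p) = (P O)⁻¹ := by
    rw [one_div, ENNReal.ofReal_inv_of_pos hp]
    congr 1
    exact ENNReal.ofReal_toReal (measure_ne_top _ _)
  have hcond : P[|O] = (γ[|C]).map (priorLin k X) := by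
    rw [ProbabilityTheory.cond, ProbabilityTheory.cond, Measure.map_smul, hCO, ← hmap,
      Measure.restrict_map hBm hOm]
  have hB : P.withDensity (fun Υ => ENNReal.ofReal (q Υ)) = (γ[|C]).map (priorLin k X) := by
    rw [← hcond]
    have h1 : (fun Υ => ENNReal.ofReal (q Υ)) = O.indicator fun _ => (P O)⁻¹ := by
      ext Υ
      by_cases h : Υ ∈ O
      · simp only [q, Set.indicator_of_mem h, hpinv]
      · simp only [q, Set.indicator_of_notMem h, ENNReal.ofReal_zero]
    rw [h1, withDensity_indicator hOm, withDensity_const]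
    rfl
  have hae : (fun ξ => Real.log (q (priorLin k X ξ))) =ᵐ[γ[|C]] fun _ => Real.log (1 / p) := by
    filter_upwards [ae_cond_mem hCm] with ξ hξ
    simp only [q]
    rw [Set.indicator_of_mem (Set.mem_preimage.1 hξ)]
  have hint : ∫ ξ, Real.log (q (priorLin k X ξ)) ∂γ[|C] = Real.log (1 / p) := by
    rw [integral_congr_ae hae]; simp
  rw [← hint]
  refine risk_le_riskBound_of_ghostMass hk_meas hk hn hδ S hu hmass
    (measurable_const.indicator hOm) (fun Υ => Set.indicator_nonneg (fun _ _ => by positivity) _)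
    (fun Υ h => Set.mem_of_indicator_ne_zero h)
    ((convex_orthant_labels S).linear_preimage (priorLin k X)) hCm hC0 hB
    ((integrable_congr hae).2 (integrable_const _)) (c := p) hp.le fun L => ?_
  have hid : Integrable (fun Υ : EuclideanSpace ℝ (Fin n) => Υ) P := by
    have h : Integrable (fun Υ : EuclideanSpace ℝ (Fin n) => Υ)
        (multivariateGaussian 0 (gramMatrix k X)) := IsGaussian.integrable_id
    exact h
  have hid2 : Integrable (fun Υ : EuclideanSpace ℝ (Fin n) => Υ) P[|O] :=
    hid.restrict.smul_measure (ENNReal.inv_ne_top.2 hO0)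
  have hcom : WithLp.toLp 2 (comLabels k X (labels S)) = ∫ Υ, Υ ∂P[|O] := rfl
  have h1 := (LinearMap.toContinuousLinearMap L).integral_comp_comm hid2
  rw [hcom]
  simp only [LinearMap.coe_toContinuousLinearMap'] at h1
  have hLm : Measurable L := L.continuous_of_finiteDimensional.measurable
  rw [← h1, hcond, integral_map hBm.aemeasurable hLm.aestronglyMeasurable,
    ProbabilityTheory.cond, integral_smul_measure, smul_eq_mul, ENNReal.toReal_inv, hCO]
  change _ = p * (p⁻¹ * _)
  rw [mul_inv_cancel_left₀ hp.ne']

end Posteriors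

end KernelPACBayes

/-- For an iid training sample `S = (X, Y)`, each of the two risk bounds fails on a sample with
invertible Gram matrix with probability at most `δ`. -/
theorem theorem1 {𝒳 : Type*} [MeasurableSpace 𝒳]
    (k : 𝒳 → 𝒳 → ℝ) (hk_meas : Measurable (Function.uncurry k))
    (hk : (Matrix.of k : Matrix 𝒳 𝒳 ℝ).PosSemidef)
    (D : Measure (𝒳 × Label)) [IsProbabilityMeasure D]
    (n : ℕ) (hn : 2 ≤ n) (δ : ℝ) (hδ : δ ∈ Set.Ioo (0 : ℝ) 1) :
    Measure.pi (fun _ : Fin n => D)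
        {S | IsUnit (gramMatrix k (inputs S)) ∧
          ¬ risk D (interpolator k (inputs S) (labels S)) ≤
            riskBound n δ (complexity k (inputs S) (labels S))}
      ≤ ENNReal.ofReal δ ∧
    Measure.pi (fun _ : Fin n => D)
        {S | IsUnit (gramMatrix k (inputs S)) ∧
          ¬ risk D (interpolator k (inputs S) (comLabels k (inputs S) (labels S))) ≤
            riskBound n δ (Real.log (1 / orthantProb k (inputs S) (labels S)))}
      ≤ ENNReal.ofReal δ := by
  -- The number of ghosts per training point is set to n. Both failure sets are contained in this
  -- one event.
  have h := measure_ghostMass_ge_le D hk_meas hk n n hδ.1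
  refine ⟨(measure_mono fun S hS => ?_).trans h, (measure_mono fun S hS => ?_).trans h⟩
  · by_contra hcon
    exact hS.2 (risk_labels_le_riskBound hk_meas hk hn hδ S hS.1 (not_le.1 hcon).le)
  · by_contra hcon
    exact hS.2 (risk_comLabels_le_riskBound hk_meas hk hn hδ S hS.1 (not_le.1 hcon).le)
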